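/- Let $d\ge 2$, $\mathcal H=\mathbb C^d\otimes\mathbb C^d$ with product basis $|i\rangle|j\rangle$, and for a unitary $U\in\mathcal U(\mathcal H)$ let $$\epsilon(U)=\int\!\!\int S_L\bigl(U|\psi_1\rangle|\psi_2\rangle\bigr)\,d\psi_1\,d\psi_2,\qquad S_L(|\psi\rangle)=\frac{d}{d-1}\bigl(1-\mathrm{Tr}\,\rho^2\bigr),\quad \rho=\mathrm{Tr}_B|\psi\rangle\langle\psi|,$$ be its entangling power, where $d\psi_1,d\psi_2$ are the uniform probability measures on the unit sphere of $\mathbb C^d$. Then $\epsilon(U)\le \frac{d}{d+1}$ for every $U\in\mathcal U(\mathcal H)$. Let $P$ be the permutation matrix with $P|i\rangle|j\rangle=|k_{ij}\rangle|l_{ij}\rangle$, where $(i,j)\mapsto(k_{ij},l_{ij})$ is a permutation of $\{1,\dots,d\}^2$. View $P$ as a $d\times d$ array of $d\times d$ blocks, the block $(k,i)$ having as its entry in sub-row $l$ and sub-column $j$ the number $\langle kl|P|ij\rangle$. Consider the four conditions: 1. every block contains one and only one nonzero entry; 2. all blocks are different; 3. nonzero entries in the same block-row are in different sub-columns; 4.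 nonzero entries in the same block-column are in different sub-rows. Then $\epsilon(P)$ equals the maximum value $\frac{d}{d+1}$ if and only if $P$ satisfies conditions 1–4. If moreover $d\notin\{2,6\}$, then $\epsilon(P)$ is maximum over $\mathcal U(\mathcal H)$, i.e. $\epsilon(U)\le\epsilon(P)$ for all $U\in\mathcal U(\mathcal H)$, if and only if $P$ satisfies conditions 1–4. Conditions 1–4 are also equivalent to $Q_P=Q_{PS}=d^2$, where $S|i\rangle|j\rangle=|j\rangle|i\rangle$ is the swap, $$Q_P=\sum_{i,j,m,n=1}^{d}a_{ijm}a_{ijn}b_{imn}b_{jmn},\qquad a_{ijm}=\langle l_{im}|l_{jm}\rangle,\quad b_{imn}=\langle k_{im}|k_{in}\rangle,$$ and $Q_{PS}$ is the same expression for the permutation $PS$. -/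

import Mathlib

open MeasureTheory

noncomputable section

namespace EntPow

/-- The uniform (normalized surface) probability measure on the unit sphere of `ℂ^d`. -/
def sphereProb (d : ℕ) : Measure (Metric.sphere (0 : EuclideanSpace ℂ (Fin d)) 1) :=
  ((volume : Measure (EuclideanSpace ℂ (Fin d))).toSphere Set.univ)⁻¹ •
    (volume : Measure (EuclideanSpace ℂ (Fin d))).toSphere

/-- The product vector `ψ₁ ⊗ ψ₂`, in coordinates: `|i⟩|j⟩` is the basis vector indexed by
`(i, j)`. -/
def prodVec {d : ℕ} (ψ₁ ψ₂ : EuclideanSpace ℂ (Fin d)) : Fin d × Fin d → ℂ :=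
  fun x => ψ₁ x.1 * ψ₂ x.2

/-- Partial trace over the second tensor factor. -/
def partialTrace {d : ℕ} (M : Matrix (Fin d × Fin d) (Fin d × Fin d) ℂ) :
    Matrix (Fin d) (Fin d) ℂ :=
  Matrix.of fun i j => ∑ b, M (i, b) (j, b)

/-- The reduced density matrix `Tr_B |ψ⟩⟨ψ|`. -/
def reducedDensity {d : ℕ} (ψ : Fin d × Fin d → ℂ) : Matrix (Fin d) (Fin d) ℂ :=
  partialTrace (Matrix.vecMulVec ψ (star ψ))

/-- The normalized linear entropy `d/(d-1) * (1 - Tr ρ²)` of the reduced density matrix `ρ`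
(the trace of `ρ²` is real). -/
def linearEntropy {d : ℕ} (ψ : Fin d × Fin d → ℂ) : ℝ :=
  (d : ℝ) / ((d : ℝ) - 1) *
    (1 - (Matrix.trace (reducedDensity ψ * reducedDensity ψ)).re)

/-- The entangling power: the average of the linear entropy of `U (ψ₁ ⊗ ψ₂)` over independent
uniform unit vectors `ψ₁`, `ψ₂` of `ℂ^d`. -/
def entanglingPower {d : ℕ} (U : Matrix (Fin d × Fin d) (Fin d × Fin d) ℂ) : ℝ :=
  ∫ ψ₁, ∫ ψ₂, linearEntropy (U.mulVec (prodVec ψ₁.1 ψ₂.1)) ∂(sphereProb d) ∂(sphereProb d)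

/-- The permutation matrix `∑ |p(i,j)⟩⟨i,j|`, that is `P |i⟩|j⟩ = |k_ij⟩|l_ij⟩` where
`p (i, j) = (k_ij, l_ij)`. -/
def permOp {d : ℕ} (p : Equiv.Perm (Fin d × Fin d)) :
    Matrix (Fin d × Fin d) (Fin d × Fin d) ℂ :=
  Matrix.of fun x y => if x = p y then 1 else 0

/-- The `(k, i)` block of a `d² × d²` matrix; inside it the row is indexed by the sub-row `l`
and the column by the sub-column `j`. -/
def block {d : ℕ} (M : Matrix (Fin d × Fin d) (Fin d × Fin d) ℂ) (k i : Fin d) :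
    Matrix (Fin d) (Fin d) ℂ :=
  Matrix.of fun l j => M (k, l) (i, j)

/-- Every block contains one and only one nonzero entry. -/
def OneEntryPerBlock {d : ℕ} (M : Matrix (Fin d × Fin d) (Fin d × Fin d) ℂ) : Prop :=
  ∀ k i, ∃! lj : Fin d × Fin d, block M k i lj.1 lj.2 ≠ 0

/-- All blocks are different. -/
def BlocksDifferent {d : ℕ} (M : Matrix (Fin d × Fin d) (Fin d × Fin d) ℂ) : Prop :=
  ∀ k i k' i', (k, i) ≠ (k', i') → block M k i ≠ block M k' i'

/-- Any two nonzero entries (at different positions) in the same block-row are in different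
sub-columns. -/
def BlockRowSubColumns {d : ℕ} (M : Matrix (Fin d × Fin d) (Fin d × Fin d) ℂ) : Prop :=
  ∀ k i l j i' l' j', block M k i l j ≠ 0 → block M k i' l' j' ≠ 0 →
    (i, l, j) ≠ (i', l', j') → j ≠ j'

/-- Any two nonzero entries (at different positions) in the same block-column are in different
sub-rows. -/
def BlockColumnSubRows {d : ℕ} (M : Matrix (Fin d × Fin d) (Fin d × Fin d) ℂ) : Prop :=
  ∀ i k l j k' l' j', block M k i l j ≠ 0 → block M k' i l' j' ≠ 0 →
    (k, l, j) ≠ (k', l', j') → l ≠ l'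

/-- The conjunction of the four conditions on the blocks. -/
def FourConditions {d : ℕ} (M : Matrix (Fin d × Fin d) (Fin d × Fin d) ℂ) : Prop :=
  OneEntryPerBlock M ∧ BlocksDifferent M ∧ BlockRowSubColumns M ∧ BlockColumnSubRows M

/-- `a_ijm = ⟨l_im | l_jm⟩`. -/
def aCoef {d : ℕ} (p : Equiv.Perm (Fin d × Fin d)) (i j m : Fin d) : ℕ :=
  if (p (i, m)).2 = (p (j, m)).2 then 1 else 0

/-- `b_imn = ⟨k_im | k_in⟩`. -/
def bCoef {d : ℕ} (p : Equiv.Perm (Fin d × Fin d)) (i m n : Fin d) : ℕ :=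
  if (p (i, m)).1 = (p (i, n)).1 then 1 else 0

/-- `Q_P = ∑_{i,j,m,n} a_ijm a_ijn b_imn b_jmn`. -/
def Q {d : ℕ} (p : Equiv.Perm (Fin d × Fin d)) : ℕ :=
  ∑ i, ∑ j, ∑ m, ∑ n, aCoef p i j m * aCoef p i j n * bCoef p i m n * bCoef p j m n

/-- The swap `S |i⟩|j⟩ = |j⟩|i⟩`, as a permutation of the product basis. -/
def swapPerm (d : ℕ) : Equiv.Perm (Fin d × Fin d) := Equiv.prodComm (Fin d) (Fin d)

end EntPow

end

/-! The averages over `ψ₁` and `ψ₂` involve only fourth moments of a uniform unit vector. By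
invariance under isometries of the sphere these are `(δ_ab δ_ce + δ_ae δ_cb) / (d (d + 1))`
(`moment_eq`). Integrating `Tr ρ²` then gives four sums: unitarity evaluates two of them to `d³`
each, and the other two are the squared Hilbert–Schmidt norms of two `d² × d²` Gram matrices, each
formed from a realignment of the entries of `U` (`entanglingPower_eq`). Both Gram matrices have
trace `d²`, so Cauchy–Schwarz bounds each squared norm below by `d²`. This is the bound `d / (d +
1)`, attained exactly when both squared norms equal `d²`.

For a permutation matrix the two squared norms count quadruples `(i, j, m, n)`, and the counts are
`Q_P` and `Q_PS`. The `d²` quadruples with `i = j`, `m = n` always contribute, so equality excludes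
all others; this says that the arrays `k` and `l` are both Latin squares (`overlapCount_eq_sq_iff`,
`IsLatinPair`). Since `p` is a bijection, these squares are orthogonal. Conditions 1–4 are the same
four injectivity statements read off the blocks (`fourConditions_permOp_iff`).

Identifying maximizers over the unitary group with permutations attaining `d / (d + 1)` needs a
permutation that attains it, that is, a pair of orthogonal Latin squares of order `d`. For `d ∉ {2,
6}` this is the Bose–Shrikhande–Parker theorem (`hasOA_of_ne`), proved with four-column orthogonal
arrays: linear arrays over rings, products, Wilson's construction, and explicit difference arrays
for orders 10 and 14. -/

noncomputable section

namespace EntPow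

/-! ### Invariance of the uniform measure on the sphere -/

/-- A linear isometry of a normed space restricted to the unit sphere. -/
def sphereMap {E : Type*} [NormedAddCommGroup E] [NormedSpace ℝ E] (g : E ≃ₗᵢ[ℝ] E) :
    Metric.sphere (0 : E) 1 → Metric.sphere (0 : E) 1 :=
  fun x => ⟨g x.1, by simp⟩

lemma continuous_sphereMap {E : Type*} [NormedAddCommGroup E] [NormedSpace ℝ E]
    (g : E ≃ₗᵢ[ℝ] E) : Continuous (sphereMap g) :=
  (g.continuous.comp continuous_subtype_val).subtype_mk _

-- The surface measure of `s` is a multiple of the volume of the cone `(0, 1) • s`; a linear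
-- isometry commutes with forming cones and preserves volume.
open scoped Pointwise in
lemma measurePreserving_sphereMap {E : Type*} [NormedAddCommGroup E] [InnerProductSpace ℝ E]
    [MeasurableSpace E] [BorelSpace E] [FiniteDimensional ℝ E] (g : E ≃ₗᵢ[ℝ] E) :
    MeasurePreserving (sphereMap g) (volume : Measure E).toSphere
      (volume : Measure E).toSphere := by
  refine ⟨(continuous_sphereMap g).measurable, ?_⟩
  ext s hs
  have hs' := (continuous_sphereMap g).measurable hs
  rw [Measure.map_apply (continuous_sphereMap g).measurable hs, Measure.toSphere_apply' _ hs',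
    Measure.toSphere_apply' _ hs]
  congr 1
  rw [← g.measurePreserving.measure_preimage_emb g.toHomeomorph.measurableEmbedding
    (Set.Ioo (0 : ℝ) 1 • (Subtype.val '' s))]
  congr 1
  ext x
  simp only [Set.mem_smul, Set.mem_preimage, Set.mem_image]
  constructor
  · rintro ⟨r, hr, _, ⟨y, hy, rfl⟩, rfl⟩
    exact ⟨r, hr, _, ⟨_, hy, rfl⟩, by simp [sphereMap]⟩
  · rintro ⟨r, hr, _, ⟨y, hy, rfl⟩, h⟩
    refine ⟨r, hr, _, ⟨sphereMap g.symm y, ?_, rfl⟩, ?_⟩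
    · have : sphereMap g (sphereMap g.symm y) = y := by ext; simp [sphereMap]
      simpa [this] using hy
    · apply g.injective
      simp [sphereMap, h]

instance (d : ℕ) : IsFiniteMeasure (sphereProb d) := by
  rcases Nat.eq_zero_or_pos d with rfl | h
  -- In dimension zero the measure is zero, so the normalizing factor `0⁻¹ = ∞` does no harm.
  · have : (volume : Measure (EuclideanSpace ℂ (Fin 0))).toSphere = 0 := by
      rw [Measure.toSphere_eq_zero_iff]; infer_instance
    rw [sphereProb, this]
    simp only [smul_zero]
    infer_instance
  · have : Nonempty (Fin d) := ⟨⟨0, h⟩⟩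
    have h0 : (volume : Measure (EuclideanSpace ℂ (Fin d))).toSphere Set.univ ≠ 0 := by
      rw [Ne, Measure.measure_univ_eq_zero]
      exact Measure.toSphere_ne_zero _
    refine ⟨?_⟩
    simp only [sphereProb, Measure.smul_apply, smul_eq_mul]
    rw [ENNReal.inv_mul_cancel h0 (measure_ne_top _ _)]
    exact ENNReal.one_lt_top

lemma isProbabilityMeasure_sphereProb {d : ℕ} (hd : 0 < d) :
    IsProbabilityMeasure (sphereProb d) := by
  have : Nonempty (Fin d) := ⟨⟨0, hd⟩⟩
  have h0 : (volume : Measure (EuclideanSpace ℂ (Fin d))).toSphere Set.univ ≠ 0 := by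
    rw [Ne, Measure.measure_univ_eq_zero]
    exact Measure.toSphere_ne_zero _
  refine ⟨?_⟩
  simp only [sphereProb, Measure.smul_apply, smul_eq_mul]
  exact ENNReal.inv_mul_cancel h0 (measure_ne_top _ _)

lemma measurePreserving_sphereMap_sphereProb {d : ℕ}
    (g : EuclideanSpace ℂ (Fin d) ≃ₗᵢ[ℝ] EuclideanSpace ℂ (Fin d)) :
    MeasurePreserving (sphereMap g) (sphereProb d) (sphereProb d) :=
  (measurePreserving_sphereMap g).smul_measure _

lemma integrable_sphereProb {d : ℕ} {F : Type*} [NormedAddCommGroup F]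
    {f : Metric.sphere (0 : EuclideanSpace ℂ (Fin d)) 1 → F} (hf : Continuous f) :
    Integrable f (sphereProb d) :=
  hf.integrable_of_hasCompactSupport (HasCompactSupport.of_compactSpace _)

lemma integral_sphereMap {d : ℕ}
    (g : EuclideanSpace ℂ (Fin d) ≃ₗᵢ[ℝ] EuclideanSpace ℂ (Fin d))
    {f : EuclideanSpace ℂ (Fin d) → ℂ} (hf : Continuous f) :
    ∫ ψ, f (g ψ.1) ∂(sphereProb d) = ∫ ψ, f ψ.1 ∂(sphereProb d) := by
  have h := measurePreserving_sphereMap_sphereProb g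
  conv_rhs => rw [← h.map_eq]
  rw [integral_map h.measurable.aemeasurable]
  · rfl
  · exact (hf.comp continuous_subtype_val).aestronglyMeasurable

/-! ### Fourth moments of a uniform unit vector -/

/-- The fourth moment `E[ψ_a ψ̄_b ψ_c ψ̄_e]` of a uniform unit vector. -/
def moment (d : ℕ) (a b c e : Fin d) : ℂ :=
  ∫ ψ, ψ.1 a * star (ψ.1 b) * (ψ.1 c * star (ψ.1 e)) ∂(sphereProb d)

/-- The imaginary unit as an element of the circle. -/
def circleI : Circle := ⟨Complex.I, mem_sphere_zero_iff_norm.2 Complex.norm_I⟩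

lemma coe_circleI : (circleI : ℂ) = Complex.I := rfl

/-- Multiplication of the coordinate `k` by `I`. -/
def phaseIsometry {d : ℕ} (k : Fin d) :
    EuclideanSpace ℂ (Fin d) ≃ₗᵢ[ℝ] EuclideanSpace ℂ (Fin d) :=
  LinearIsometryEquiv.piLpCongrRight 2 fun i =>
    if i = k then rotation circleI
      else LinearIsometryEquiv.refl ℝ ℂ

lemma phaseIsometry_apply {d : ℕ} (k a : Fin d) (ψ : EuclideanSpace ℂ (Fin d)) :
    phaseIsometry k ψ a = (if a = k then Complex.I else 1) * ψ a := by
  simp only [phaseIsometry, LinearIsometryEquiv.piLpCongrRight_apply]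
  split_ifs with h
  · simp [rotation_apply, coe_circleI]
  · simp

lemma moment_eq_phase_mul {d : ℕ} (k a b c e : Fin d) :
    moment d a b c e = ((if a = k then Complex.I else 1) * star (if b = k then Complex.I else 1) *
      ((if c = k then Complex.I else 1) * star (if e = k then Complex.I else 1))) *
      moment d a b c e := by
  conv_lhs => rw [moment]
  rw [← integral_sphereMap (phaseIsometry k)
    (f := fun ψ => ψ a * star (ψ b) * (ψ c * star (ψ e))) (by fun_prop), moment,
    ← integral_const_mul]
  congr 1
  ext ψ
  simp only [phaseIsometry_apply, star_mul']
  ring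

/-- Multiplying one coordinate by `I` multiplies the moment by a phase, which differs from 1 for a
suitable coordinate unless the indices pair up. The factor `-1` would not suffice: it does not
detect `E[ψ_a² ψ̄_b²]`, where `I` produces `-1`. -/
lemma moment_eq_zero {d : ℕ} {a b c e : Fin d} (h : ¬((a = b ∧ c = e) ∨ (a = e ∧ c = b))) :
    moment d a b c e = 0 := by
  have key : ∀ {z m : ℂ}, z ≠ 1 → m = z * m → m = 0 := by
    intro z m hz hm
    have : (z - 1) * m = 0 := by linear_combination -hm
    exact (mul_eq_zero.1 this).resolve_left (sub_ne_zero.2 hz)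
  have hI : Complex.I ≠ 1 := fun h => by simpa using congrArg Complex.re h
  by_cases hab : a = b
  · have hce : c ≠ e := fun hce => h (Or.inl ⟨hab, hce⟩)
    refine key ?_ (moment_eq_phase_mul c a b c e)
    subst hab
    by_cases hac : a = c
    · simp [hac, hce.symm, hI]
    · simp [hac, hce.symm, hI]
  · by_cases hae : a = e
    · have hcb : c ≠ b := fun hcb => h (Or.inr ⟨hae, hcb⟩)
      refine key ?_ (moment_eq_phase_mul c a b c e)
      subst hae
      by_cases hac : a = c
      · simp [hac, hcb.symm, hI]
      · simp [hac, hcb.symm, hI]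
    · refine key ?_ (moment_eq_phase_mul a a b c e)
      by_cases hac : c = a
      · simp only [hac, if_true, Ne.symm hab, Ne.symm hae, if_false, star_one, mul_one,
          Complex.I_mul_I]
        norm_num
      · simp [hac, Ne.symm hab, Ne.symm hae, hI]

/-- The reflection in the complex line spanned by `e_a + 2 e_b`. -/
def lineReflection {d : ℕ} (a b : Fin d) :
    EuclideanSpace ℂ (Fin d) ≃ₗᵢ[ℝ] EuclideanSpace ℂ (Fin d) :=
  { (ℂ ∙ (EuclideanSpace.single a (1 : ℂ) +
      EuclideanSpace.single b (2 : ℂ))).reflection.toLinearEquiv.restrictScalars ℝ with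
    norm_map' := (ℂ ∙ (EuclideanSpace.single a (1 : ℂ) +
      EuclideanSpace.single b (2 : ℂ))).reflection.norm_map }

/-- The vector `e_a + 2 e_b` is chosen to keep the coefficients rational while genuinely mixing the
two coordinates; reflecting in `e_a + e_b` would only exchange them. -/
lemma lineReflection_apply {d : ℕ} {a b : Fin d} (hab : a ≠ b)
    (ψ : EuclideanSpace ℂ (Fin d)) :
    lineReflection a b ψ a = (4 * ψ b - 3 * ψ a) / 5 := by
  have hn : ‖EuclideanSpace.single a (1 : ℂ) + EuclideanSpace.single b (2 : ℂ)‖ ^ 2 = 5 := by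
    rw [@norm_add_sq ℂ]
    simp [EuclideanSpace.inner_single_left, hab]
    norm_num
  have : lineReflection a b ψ = (ℂ ∙ (EuclideanSpace.single a (1 : ℂ) +
    EuclideanSpace.single b (2 : ℂ))).reflection ψ := rfl
  rw [this, Submodule.reflection_singleton_apply]
  rw [← RCLike.ofReal_pow, hn]
  simp [inner_add_left, EuclideanSpace.inner_single_left, hab]
  rw [map_ofNat (starRingEnd ℂ) 2]
  ring

lemma moment_swap {d : ℕ} (a b c e : Fin d) : moment d a b c e = moment d a e c b := by
  unfold moment
  congr 1
  ext ψ
  ring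

lemma moment_comm {d : ℕ} (a b c e : Fin d) : moment d a b c e = moment d c e a b := by
  unfold moment
  congr 1
  ext ψ
  ring

/-- Invariance under the reflection, with `((4 ψ_b - 3 ψ_a) / 5)` expanded to fourth order. Of the
sixteen terms, the two pure ones have weights `4⁴` and `3⁴`, and four mixed ones survive with weight
`4² · 3²` each. -/
lemma moment_reflection {d : ℕ} {a b : Fin d} (hab : a ≠ b) :
    625 * moment d a a a a =
      256 * moment d b b b b + 81 * moment d a a a a + 576 * moment d a a b b := by
  have h := integral_sphereMap (lineReflection a b)
    (f := fun ψ => ψ a * star (ψ a) * (ψ a * star (ψ a))) (by fun_prop)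
  have hE : ∀ ψ : Metric.sphere (0 : EuclideanSpace ℂ (Fin d)) 1,
      625 * (lineReflection a b ψ.1 a * star (lineReflection a b ψ.1 a) *
        (lineReflection a b ψ.1 a * star (lineReflection a b ψ.1 a))) =
      ∑ x : Fin 2, ∑ y : Fin 2, ∑ z : Fin 2, ∑ w : Fin 2,
        (![4, -3] x * ![4, -3] y * ![4, -3] z * ![4, -3] w : ℂ) *
          (ψ.1 (![b, a] x) * star (ψ.1 (![b, a] y)) *
            (ψ.1 (![b, a] z) * star (ψ.1 (![b, a] w)))) := by
    intro ψ
    rw [lineReflection_apply hab]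
    simp only [Fin.sum_univ_two, Matrix.cons_val_zero, Matrix.cons_val_one, star_div₀, star_sub,
      star_mul']
    have h4 : star (4 : ℂ) = 4 := by simp
    have h3 : star (3 : ℂ) = 3 := by simp
    have h5 : star (5 : ℂ) = 5 := by simp
    rw [h4, h3, h5]
    ring
  have hsum : 625 * moment d a a a a = ∑ x : Fin 2, ∑ y : Fin 2, ∑ z : Fin 2, ∑ w : Fin 2,
        (![4, -3] x * ![4, -3] y * ![4, -3] z * ![4, -3] w : ℂ) *
          moment d (![b, a] x) (![b, a] y) (![b, a] z) (![b, a] w) := by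
    unfold moment
    rw [← h, ← integral_const_mul, integral_congr_ae (Filter.Eventually.of_forall hE)]
    simp_rw [← integral_const_mul]
    have hc : ∀ x y z w : Fin 2, Continuous
        fun ψ : Metric.sphere (0 : EuclideanSpace ℂ (Fin d)) 1 =>
        (![4, -3] x * ![4, -3] y * ![4, -3] z * ![4, -3] w : ℂ) *
          (ψ.1 (![b, a] x) * star (ψ.1 (![b, a] y)) *
            (ψ.1 (![b, a] z) * star (ψ.1 (![b, a] w)))) := by
      intro x y z w
      fun_prop
    rw [integral_finsetSum _ fun x _ => integrable_finsetSum _ fun y _ => integrable_finsetSum _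
      fun z _ => integrable_finsetSum _ fun w _ => integrable_sphereProb (hc x y z w)]
    refine Finset.sum_congr rfl fun x _ => ?_
    rw [integral_finsetSum _ fun y _ => integrable_finsetSum _
      fun z _ => integrable_finsetSum _ fun w _ => integrable_sphereProb (hc x y z w)]
    refine Finset.sum_congr rfl fun y _ => ?_
    rw [integral_finsetSum _
      fun z _ => integrable_finsetSum _ fun w _ => integrable_sphereProb (hc x y z w)]
    refine Finset.sum_congr rfl fun z _ => ?_
    rw [integral_finsetSum _ fun w _ => integrable_sphereProb (hc x y z w)]
  rw [hsum]
  simp only [Fin.sum_univ_two, Matrix.cons_val_zero, Matrix.cons_val_one]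
  have z1 : moment d b b b a = 0 := moment_eq_zero (by grind)
  have z2 : moment d b b a b = 0 := moment_eq_zero (by grind)
  have z3 : moment d b a b b = 0 := moment_eq_zero (by grind)
  have z4 : moment d a b b b = 0 := moment_eq_zero (by grind)
  have z5 : moment d a a a b = 0 := moment_eq_zero (by grind)
  have z6 : moment d a a b a = 0 := moment_eq_zero (by grind)
  have z7 : moment d a b a a = 0 := moment_eq_zero (by grind)
  have z8 : moment d b a a a = 0 := moment_eq_zero (by grind)
  have z9 : moment d a b a b = 0 := moment_eq_zero (by grind)
  have z10 : moment d b a b a = 0 := moment_eq_zero (by grind)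
  have e1 : moment d b b a a = moment d a a b b := moment_comm _ _ _ _
  have e2 : moment d a b b a = moment d a a b b := moment_swap _ _ _ _
  have e3 : moment d b a a b = moment d a a b b := by rw [moment_swap, e1]
  rw [z1, z2, z3, z4, z5, z6, z7, z8, z9, z10, e1, e2, e3]
  ring

/-- The reflection identity for `(a, b)` and for `(b, a)` gives two linear equations: their
difference equates the pure moments, and either one then gives the ratio 2. -/
lemma moment_diag {d : ℕ} (a b : Fin d) :
    moment d b b b b = moment d a a a a ∧
      (a ≠ b → moment d a a a a = 2 * moment d a a b b) := by
  by_cases hab : a = b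
  · subst hab; simp
  · have h1 := moment_reflection hab
    have h2 := moment_reflection (Ne.symm hab)
    rw [moment_comm b b a a] at h2
    have h0 : moment d b b b b = moment d a a a a := by linear_combination (h2 - h1) / 800
    refine ⟨h0, fun _ => ?_⟩
    rw [h0] at h1
    linear_combination h1 / 288

lemma sum_moment_eq_one {d : ℕ} (hd : 0 < d) : ∑ a, ∑ c, moment d a a c c = 1 := by
  have := isProbabilityMeasure_sphereProb hd
  have hc : ∀ a c : Fin d, Continuous fun ψ : Metric.sphere (0 : EuclideanSpace ℂ (Fin d)) 1 =>
      ψ.1 a * star (ψ.1 a) * (ψ.1 c * star (ψ.1 c)) := fun a c => by fun_prop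
  have h1 : ∑ a, ∑ c, moment d a a c c = ∫ ψ, ∑ a, ∑ c,
      ψ.1 a * star (ψ.1 a) * (ψ.1 c * star (ψ.1 c)) ∂(sphereProb d) := by
    rw [integral_finsetSum _ fun a _ => integrable_finsetSum _ fun c _ =>
      integrable_sphereProb (hc a c)]
    refine Finset.sum_congr rfl fun a _ => ?_
    rw [integral_finsetSum _ fun c _ => integrable_sphereProb (hc a c)]
    rfl
  have h2 : ∀ ψ : Metric.sphere (0 : EuclideanSpace ℂ (Fin d)) 1,
      ∑ a, ∑ c, ψ.1 a * star (ψ.1 a) * (ψ.1 c * star (ψ.1 c)) = 1 := by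
    intro ψ
    have hn : ‖ψ.1‖ = 1 := by simp
    have hs : ∑ a, ψ.1 a * star (ψ.1 a) = 1 := by
      have h3 : ∑ a, ‖ψ.1 a‖ ^ 2 = 1 := by
        rw [← EuclideanSpace.norm_sq_eq, hn, one_pow]
      have h4 := congrArg (fun x : ℝ => (x : ℂ)) h3
      push_cast at h4
      rw [← h4]
      refine Finset.sum_congr rfl fun a _ => ?_
      exact Complex.mul_conj' _
    rw [← Finset.sum_mul_sum, hs, one_mul]
  rw [h1, integral_congr_ae (Filter.Eventually.of_forall h2)]
  simp

/-- The fourth moments of a uniform unit vector of `ℂ^d`. -/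
lemma moment_eq {d : ℕ} (hd : 0 < d) (a b c e : Fin d) :
    moment d a b c e = ((if a = b then 1 else 0) * (if c = e then 1 else 0) +
      (if a = e then 1 else 0) * (if c = b then 1 else 0)) / ((d : ℂ) * (d + 1)) := by
  have hd0 : (d : ℂ) ≠ 0 := by exact_mod_cast hd.ne'
  have hd1 : (d : ℂ) + 1 ≠ 0 := by exact_mod_cast (Nat.succ_ne_zero d)
  have hA : ∀ x y : Fin d,
      moment d x x y y = (1 + if x = y then 1 else 0) * (moment d a a a a / 2) := by
    intro x y
    rw [← (moment_diag a x).1]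
    split_ifs with h
    · subst h; ring
    · rw [(moment_diag x y).2 h]; ring
  -- The normalization `‖ψ‖⁴ = 1` fixes the one remaining constant: the weights `1 + δ_xy` sum to
  -- `d² + d`.
  have hA1 : moment d a a a a = 2 / ((d : ℂ) * (d + 1)) := by
    have h := sum_moment_eq_one hd
    rw [Finset.sum_congr rfl fun x _ => Finset.sum_congr rfl fun y _ => hA x y] at h
    simp_rw [add_mul, Finset.sum_add_distrib, ← Finset.sum_mul] at h
    simp at h
    field_simp
    linear_combination 2 * h
  have hA' : ∀ x y : Fin d,
      moment d x x y y = (1 + if x = y then 1 else 0) / ((d : ℂ) * (d + 1)) := by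
    intro x y
    rw [hA, hA1]
    ring
  by_cases h1 : a = b ∧ c = e
  · obtain ⟨rfl, rfl⟩ := h1
    rw [hA']
    by_cases h : a = c
    · simp [h]
    · simp [h]
  · by_cases h2 : a = e ∧ c = b
    · obtain ⟨rfl, rfl⟩ := h2
      rw [moment_swap, hA']
      by_cases h : a = c
      · simp [h]
      · simp [h]
    · rw [moment_eq_zero (not_or.2 ⟨h1, h2⟩)]
      rw [not_and] at h1 h2
      by_cases h : a = b <;> by_cases h' : a = e <;> simp_all

/-! ### Averages of quartic expressions over product vectors -/

lemma integral_sum_sphereProb {d : ℕ} {ι : Type*} [Fintype ι]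
    {f : ι → Metric.sphere (0 : EuclideanSpace ℂ (Fin d)) 1 → ℂ} (hf : ∀ i, Continuous (f i)) :
    ∫ ψ, ∑ i, f i ψ ∂(sphereProb d) = ∑ i, ∫ ψ, f i ψ ∂(sphereProb d) :=
  integral_finsetSum _ fun i _ => integrable_sphereProb (hf i)

/-- The linear form with coefficients `A`. -/
def linForm {d : ℕ} (A : Fin d → ℂ) (ψ : EuclideanSpace ℂ (Fin d)) : ℂ := ∑ a, A a * ψ a

@[fun_prop]
lemma continuous_linForm {d : ℕ} (A : Fin d → ℂ) : Continuous (linForm A) := by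
  unfold linForm
  fun_prop

/-- The sesquilinear product `∑ a, A a * conj (B a)`. -/
def dotStar {ι : Type*} [Fintype ι] (A B : ι → ℂ) : ℂ := ∑ a, A a * star (B a)

lemma sum_mul_sum_eq_sum_prod {ι κ : Type*} [Fintype ι] [Fintype κ] (f : ι → ℂ) (g : κ → ℂ) :
    (∑ a, f a) * (∑ b, g b) = ∑ x : ι × κ, f x.1 * g x.2 := by
  rw [Fintype.sum_prod_type, Finset.sum_mul_sum]

lemma integral_quartic {d : ℕ} (hd : 0 < d) (A B C D : Fin d → ℂ) :
    ∫ ψ, linForm A ψ.1 * star (linForm B ψ.1) * (linForm C ψ.1 * star (linForm D ψ.1))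
      ∂(sphereProb d) =
    (dotStar A B * dotStar C D + dotStar A D * dotStar C B) / ((d : ℂ) * (d + 1)) := by
  have hE : ∀ ψ : EuclideanSpace ℂ (Fin d),
      linForm A ψ * star (linForm B ψ) * (linForm C ψ * star (linForm D ψ)) =
      ∑ x : (Fin d × Fin d) × (Fin d × Fin d),
        (A x.1.1 * star (B x.1.2) * (C x.2.1 * star (D x.2.2))) *
          (ψ x.1.1 * star (ψ x.1.2) * (ψ x.2.1 * star (ψ x.2.2))) := by
    intro ψ
    simp only [linForm, star_sum, sum_mul_sum_eq_sum_prod, star_mul']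
    exact Finset.sum_congr rfl fun x _ => by ring
  simp_rw [hE]
  rw [integral_sum_sphereProb fun x => by fun_prop]
  simp_rw [integral_const_mul]
  have hm : ∀ x : (Fin d × Fin d) × (Fin d × Fin d),
      ∫ ψ, ψ.1 x.1.1 * star (ψ.1 x.1.2) * (ψ.1 x.2.1 * star (ψ.1 x.2.2)) ∂(sphereProb d) =
        ((if x.1.1 = x.1.2 then 1 else 0) * (if x.2.1 = x.2.2 then 1 else 0) +
      (if x.1.1 = x.2.2 then 1 else 0) * (if x.2.1 = x.1.2 then 1 else 0)) /
        ((d : ℂ) * (d + 1)) := fun x => moment_eq hd _ _ _ _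
  simp_rw [hm, ← mul_div_assoc]
  rw [← Finset.sum_div]
  congr 1
  simp only [mul_add, Finset.sum_add_distrib, Fintype.sum_prod_type, dotStar]
  congr 1
  · simp only [mul_ite, mul_one, mul_zero, Finset.sum_ite_eq,
      Finset.mem_univ, if_true, Finset.sum_mul_sum, Finset.sum_const_zero,
      Finset.sum_ite_irrel]
  · simp only [mul_ite, mul_one, mul_zero, Finset.sum_ite_eq,
      Finset.sum_ite_eq', Finset.mem_univ, if_true, Finset.sum_mul_sum, Finset.sum_const_zero,
      Finset.sum_ite_irrel]
    refine Finset.sum_congr rfl fun a _ => Finset.sum_congr rfl fun b _ => ?_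
    ring

/-- The bilinear form with coefficients `A`. -/
def bilForm {d : ℕ} (A : Fin d × Fin d → ℂ) (ψ₁ ψ₂ : EuclideanSpace ℂ (Fin d)) : ℂ :=
  linForm (fun n => linForm (fun m => A (m, n)) ψ₁) ψ₂

lemma mulVec_prodVec {d : ℕ} (U : Matrix (Fin d × Fin d) (Fin d × Fin d) ℂ)
    (ψ₁ ψ₂ : EuclideanSpace ℂ (Fin d)) (x : Fin d × Fin d) :
    U.mulVec (prodVec ψ₁ ψ₂) x = bilForm (U x) ψ₁ ψ₂ := by
  simp only [Matrix.mulVec, dotProduct, prodVec, bilForm, linForm, Finset.sum_mul,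
    Fintype.sum_prod_type]
  rw [Finset.sum_comm]
  refine Finset.sum_congr rfl fun a _ => Finset.sum_congr rfl fun b _ => ?_
  ring

/-- The product `A B̄ C D̄` of four bilinear forms. -/
def quarticForm {d : ℕ} (A B C D : Fin d × Fin d → ℂ)
    (ψ₁ ψ₂ : EuclideanSpace ℂ (Fin d)) : ℂ :=
  bilForm A ψ₁ ψ₂ * star (bilForm B ψ₁ ψ₂) * (bilForm C ψ₁ ψ₂ * star (bilForm D ψ₁ ψ₂))

lemma integral_quarticForm {d : ℕ} (hd : 0 < d) (A B C D : Fin d × Fin d → ℂ)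
    (ψ₁ : EuclideanSpace ℂ (Fin d)) :
    ∫ ψ₂, quarticForm A B C D ψ₁ ψ₂.1 ∂(sphereProb d) =
      (∑ x : Fin d × Fin d,
        (linForm (fun m => A (m, x.1)) ψ₁ * star (linForm (fun m => B (m, x.1)) ψ₁) *
          (linForm (fun m => C (m, x.2)) ψ₁ * star (linForm (fun m => D (m, x.2)) ψ₁)) +
        linForm (fun m => A (m, x.1)) ψ₁ * star (linForm (fun m => D (m, x.1)) ψ₁) *
          (linForm (fun m => C (m, x.2)) ψ₁ * star (linForm (fun m => B (m, x.2)) ψ₁)))) /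
      ((d : ℂ) * (d + 1)) := by
  simp only [quarticForm, bilForm]
  rw [integral_quartic hd, Finset.sum_add_distrib]
  simp only [dotStar, sum_mul_sum_eq_sum_prod]

lemma continuous_integral_quarticForm {d : ℕ} (A B C D : Fin d × Fin d → ℂ) :
    Continuous fun ψ₁ : EuclideanSpace ℂ (Fin d) =>
      ∫ ψ₂, quarticForm A B C D ψ₁ ψ₂.1 ∂(sphereProb d) := by
  rcases Nat.eq_zero_or_pos d with rfl | hd
  · exact continuous_of_const fun x y => by rw [Subsingleton.elim x y]
  · simp_rw [integral_quarticForm hd]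
    fun_prop

/-- Each integration pairs the unconjugated factors with the conjugated ones in two ways. When the
two integrations choose the same pairing, full inner products appear; the mixed choices give the two
partially contracted sums. -/
lemma integral_integral_quarticForm {d : ℕ} (hd : 0 < d) (A B C D : Fin d × Fin d → ℂ) :
    ∫ ψ₁, ∫ ψ₂, quarticForm A B C D ψ₁.1 ψ₂.1 ∂(sphereProb d) ∂(sphereProb d) =
      (dotStar A B * dotStar C D + dotStar A D * dotStar C B +
        (∑ n, ∑ n', dotStar (fun m => A (m, n)) (fun m => D (m, n')) *
          dotStar (fun m => C (m, n')) (fun m => B (m, n)) +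
        ∑ n, ∑ n', dotStar (fun m => A (m, n)) (fun m => B (m, n')) *
          dotStar (fun m => C (m, n')) (fun m => D (m, n)))) / ((d : ℂ) * (d + 1)) ^ 2 := by
  have hdd : ∀ F G : Fin d × Fin d → ℂ,
      dotStar F G = ∑ n, dotStar (fun m => F (m, n)) (fun m => G (m, n)) := by
    intro F G
    simp only [dotStar, Fintype.sum_prod_type]
    exact Finset.sum_comm
  simp_rw [integral_quarticForm hd]
  rw [integral_div, integral_sum_sphereProb fun x => by fun_prop]
  have h2 : ∀ x : Fin d × Fin d, ∫ ψ₁ : Metric.sphere (0 : EuclideanSpace ℂ (Fin d)) 1,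
      (linForm (fun m => A (m, x.1)) ψ₁.1 * star (linForm (fun m => B (m, x.1)) ψ₁.1) *
          (linForm (fun m => C (m, x.2)) ψ₁.1 * star (linForm (fun m => D (m, x.2)) ψ₁.1)) +
        linForm (fun m => A (m, x.1)) ψ₁.1 * star (linForm (fun m => D (m, x.1)) ψ₁.1) *
          (linForm (fun m => C (m, x.2)) ψ₁.1 * star (linForm (fun m => B (m, x.2)) ψ₁.1)))
        ∂(sphereProb d) = _ := fun x => by
    rw [integral_add (integrable_sphereProb (by fun_prop)) (integrable_sphereProb (by fun_prop)),
      integral_quartic hd, integral_quartic hd]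
  simp_rw [h2, ← add_div]
  rw [← Finset.sum_div, div_div, ← pow_two]
  congr 1
  rw [hdd A B, hdd C D, hdd A D, hdd C B, Finset.sum_mul_sum, Finset.sum_mul_sum]
  simp only [Finset.sum_add_distrib, Fintype.sum_prod_type]
  ring

/-! ### The entangling power through Gram matrices, and its upper bound -/

/-- The Gram matrix of the coefficients of `U` regrouped by the second output and second input. -/
def gramSnd {d : ℕ} (U : Matrix (Fin d × Fin d) (Fin d × Fin d) ℂ) :
    Matrix (Fin d × Fin d) (Fin d × Fin d) ℂ :=
  Matrix.of fun p q => ∑ i, ∑ m, U (i, p.1) (m, p.2) * star (U (i, q.1) (m, q.2))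

/-- The Gram matrix of the coefficients of `U` regrouped by the first output and second input. -/
def gramFst {d : ℕ} (U : Matrix (Fin d × Fin d) (Fin d × Fin d) ℂ) :
    Matrix (Fin d × Fin d) (Fin d × Fin d) ℂ :=
  Matrix.of fun p q => ∑ b, ∑ m, U (p.1, b) (m, p.2) * star (U (q.1, b) (m, q.2))

/-- The sum of the squared moduli of the entries of a matrix. -/
def sumNormSq {ι : Type*} [Fintype ι] (N : Matrix ι ι ℂ) : ℝ := ∑ p, ∑ q, ‖N p q‖ ^ 2

/-- Cauchy–Schwarz on the diagonal, after which the off-diagonal entries are added for free. -/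
lemma sq_norm_trace_le {ι : Type*} [Fintype ι] (N : Matrix ι ι ℂ) :
    ‖N.trace‖ ^ 2 ≤ Fintype.card ι * sumNormSq N := by
  have h1 : ‖N.trace‖ ≤ ∑ p, ‖N p p‖ := norm_sum_le _ _
  have h2 : (∑ p, ‖N p p‖) ^ 2 ≤ Fintype.card ι * ∑ p, ‖N p p‖ ^ 2 :=
    sq_sum_le_card_mul_sum_sq
  have h3 : ∑ p, ‖N p p‖ ^ 2 ≤ sumNormSq N := Finset.sum_le_sum fun p _ =>
    Finset.single_le_sum (f := fun q => ‖N p q‖ ^ 2) (fun q _ => by positivity)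
      (Finset.mem_univ p)
  calc ‖N.trace‖ ^ 2 ≤ (∑ p, ‖N p p‖) ^ 2 := by gcongr
    _ ≤ _ := h2
    _ ≤ _ := by gcongr

lemma dotStar_row {d : ℕ} {U : Matrix (Fin d × Fin d) (Fin d × Fin d) ℂ}
    (hU : U ∈ Matrix.unitaryGroup (Fin d × Fin d) ℂ) (x y : Fin d × Fin d) :
    dotStar (U x) (U y) = if x = y then 1 else 0 := by
  have h := congrFun (congrFun (Matrix.mem_unitaryGroup_iff.1 hU) x) y
  rw [Matrix.one_apply] at h
  rw [← h]
  rfl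

lemma trace_gramSnd {d : ℕ} {U : Matrix (Fin d × Fin d) (Fin d × Fin d) ℂ}
    (hU : U ∈ Matrix.unitaryGroup (Fin d × Fin d) ℂ) : (gramSnd U).trace = (d : ℂ) ^ 2 := by
  have h : (gramSnd U).trace = ∑ x : Fin d × Fin d, dotStar (U x) (U x) := by
    simp only [Matrix.trace, Matrix.diag, gramSnd, dotStar, Matrix.of_apply, Fintype.sum_prod_type]
    simp_rw [fun b : Fin d => Finset.sum_comm (s := (Finset.univ : Finset (Fin d)))
      (t := (Finset.univ : Finset (Fin d)))
      (f := fun n i => ∑ m, U (i, b) (m, n) * star (U (i, b) (m, n)))]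
    rw [Finset.sum_comm]
    exact Finset.sum_congr rfl fun i _ => Finset.sum_congr rfl fun b _ => Finset.sum_comm
  rw [h]
  simp [dotStar_row hU, pow_two]

lemma trace_gramFst {d : ℕ} {U : Matrix (Fin d × Fin d) (Fin d × Fin d) ℂ}
    (hU : U ∈ Matrix.unitaryGroup (Fin d × Fin d) ℂ) : (gramFst U).trace = (d : ℂ) ^ 2 := by
  have h : (gramFst U).trace = ∑ x : Fin d × Fin d, dotStar (U x) (U x) := by
    simp only [Matrix.trace, Matrix.diag, gramFst, dotStar, Matrix.of_apply, Fintype.sum_prod_type]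
    refine Finset.sum_congr rfl fun i _ => ?_
    rw [Finset.sum_comm]
    refine Finset.sum_congr rfl fun b _ => Finset.sum_comm
  rw [h]
  simp [dotStar_row hU, pow_two]

lemma sq_le_sumNormSq_of_trace {d : ℕ} (hd : 0 < d) {N : Matrix (Fin d × Fin d) (Fin d × Fin d) ℂ}
    (h : N.trace = (d : ℂ) ^ 2) : (d : ℝ) ^ 2 ≤ sumNormSq N := by
  have h1 := sq_norm_trace_le N
  have hd' : (0 : ℝ) < (d : ℝ) * d := by positivity
  simp only [h, norm_pow, Complex.norm_natCast, Fintype.card_prod, Fintype.card_fin,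
    Nat.cast_mul] at h1
  refine le_of_mul_le_mul_left ?_ hd'
  linarith [h1]

lemma trace_reducedDensity_sq {d : ℕ} (U : Matrix (Fin d × Fin d) (Fin d × Fin d) ℂ)
    (ψ₁ ψ₂ : EuclideanSpace ℂ (Fin d)) :
    (reducedDensity (U.mulVec (prodVec ψ₁ ψ₂)) *
      reducedDensity (U.mulVec (prodVec ψ₁ ψ₂))).trace =
    ∑ x : (Fin d × Fin d) × (Fin d × Fin d),
      quarticForm (U (x.1.1, x.2.1)) (U (x.1.2, x.2.1)) (U (x.1.2, x.2.2)) (U (x.1.1, x.2.2))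
        ψ₁ ψ₂ := by
  simp only [Matrix.trace, Matrix.diag, Matrix.mul_apply, reducedDensity, partialTrace,
    Matrix.of_apply, Matrix.vecMulVec_apply, Pi.star_apply, mulVec_prodVec, Finset.sum_mul_sum,
    Fintype.sum_prod_type, quarticForm]

/-- Collects the output index that stays fixed within each inner product with the input index, so
that the summand becomes a product of two Gram entries at `(p, q)`. -/
lemma sum_regroup {ι κ ν : Type*} [Fintype ι] [Fintype κ] [Fintype ν]
    (f : ι → ι → κ → κ → ν → ν → ℂ) :
    ∑ x : (ι × ι) × (κ × κ), ∑ n, ∑ n', f x.1.1 x.1.2 x.2.1 x.2.2 n n' =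
      ∑ p : κ × ν, ∑ q : κ × ν, ∑ i, ∑ j, f i j p.1 q.1 p.2 q.2 := by
  let e : (((ι × ι) × (κ × κ)) × (ν × ν)) ≃ (((κ × ν) × (κ × ν)) × (ι × ι)) :=
    { toFun := fun z => (((z.1.2.1, z.2.1), (z.1.2.2, z.2.2)), z.1.1)
      invFun := fun z => ((z.2, (z.1.1.1, z.1.2.1)), (z.1.1.2, z.1.2.2))
      left_inv := fun _ => rfl
      right_inv := fun _ => rfl }
  have h := Fintype.sum_equiv e
    (fun z => f z.1.1.1 z.1.1.2 z.1.2.1 z.1.2.2 z.2.1 z.2.2)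
    (fun z => f z.2.1 z.2.2 z.1.1.1 z.1.2.1 z.1.1.2 z.1.2.2) fun _ => rfl
  simpa only [Fintype.sum_prod_type] using h

lemma sum_regroup' {ι κ ν : Type*} [Fintype ι] [Fintype κ] [Fintype ν]
    (f : ι → ι → κ → κ → ν → ν → ℂ) :
    ∑ x : (ι × ι) × (κ × κ), ∑ n, ∑ n', f x.1.1 x.1.2 x.2.1 x.2.2 n n' =
      ∑ p : ι × ν, ∑ q : ι × ν, ∑ b, ∑ c, f p.1 q.1 b c p.2 q.2 := by
  rw [← sum_regroup fun b c i j n n' => f i j b c n n']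
  exact Fintype.sum_equiv (Equiv.prodComm _ _) _ _ fun _ => rfl

lemma star_dotStar {ι : Type*} [Fintype ι] (A B : ι → ℂ) : star (dotStar A B) = dotStar B A := by
  simp only [dotStar, star_sum, star_mul', star_star]
  exact Finset.sum_congr rfl fun _ _ => mul_comm _ _

lemma integral_trace_reducedDensity_sq {d : ℕ} (hd : 0 < d)
    {U : Matrix (Fin d × Fin d) (Fin d × Fin d) ℂ}
    (hU : U ∈ Matrix.unitaryGroup (Fin d × Fin d) ℂ) :
    ∑ x : (Fin d × Fin d) × (Fin d × Fin d), ∫ ψ₁, ∫ ψ₂,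
      quarticForm (U (x.1.1, x.2.1)) (U (x.1.2, x.2.1)) (U (x.1.2, x.2.2)) (U (x.1.1, x.2.2))
        ψ₁.1 ψ₂.1 ∂(sphereProb d) ∂(sphereProb d) =
    ((2 * (d : ℝ) ^ 3 + sumNormSq (gramSnd U) + sumNormSq (gramFst U)) /
      ((d : ℝ) * (d + 1)) ^ 2 : ℝ) := by
  simp_rw [integral_integral_quarticForm hd, dotStar_row hU]
  rw [← Finset.sum_div]
  push_cast
  congr 1
  simp only [Finset.sum_add_distrib]
  have h1 : ∀ z : ℂ, (‖z‖ : ℂ) ^ 2 = z * star z := fun z => (Complex.mul_conj' z).symm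
  have hS : ∑ x : (Fin d × Fin d) × (Fin d × Fin d), ∑ n, ∑ n',
      dotStar (fun m => U (x.1.1, x.2.1) (m, n)) (fun m => U (x.1.1, x.2.2) (m, n')) *
        dotStar (fun m => U (x.1.2, x.2.2) (m, n')) (fun m => U (x.1.2, x.2.1) (m, n)) =
      sumNormSq (gramSnd U) := by
    rw [sum_regroup fun i j b c n n' => dotStar (fun m => U (i, b) (m, n))
      (fun m => U (i, c) (m, n')) *
        dotStar (fun m => U (j, c) (m, n')) (fun m => U (j, b) (m, n))]
    simp only [sumNormSq, Complex.ofReal_sum, Complex.ofReal_pow, h1]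
    refine Finset.sum_congr rfl fun p _ => Finset.sum_congr rfl fun q _ => ?_
    have : gramSnd U p q =
      ∑ i, dotStar (fun m => U (i, p.1) (m, p.2)) (fun m => U (i, q.1) (m, q.2)) := rfl
    rw [this, star_sum, Finset.sum_mul_sum]
    simp only [star_dotStar]
  have hF : ∑ x : (Fin d × Fin d) × (Fin d × Fin d), ∑ n, ∑ n',
      dotStar (fun m => U (x.1.1, x.2.1) (m, n)) (fun m => U (x.1.2, x.2.1) (m, n')) *
        dotStar (fun m => U (x.1.2, x.2.2) (m, n')) (fun m => U (x.1.1, x.2.2) (m, n)) =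
      sumNormSq (gramFst U) := by
    rw [sum_regroup' fun i j b c n n' => dotStar (fun m => U (i, b) (m, n))
      (fun m => U (j, b) (m, n')) *
        dotStar (fun m => U (j, c) (m, n')) (fun m => U (i, c) (m, n))]
    simp only [sumNormSq, Complex.ofReal_sum, Complex.ofReal_pow, h1]
    refine Finset.sum_congr rfl fun p _ => Finset.sum_congr rfl fun q _ => ?_
    have : gramFst U p q =
      ∑ b, dotStar (fun m => U (p.1, b) (m, p.2)) (fun m => U (q.1, b) (m, q.2)) := rfl
    rw [this, star_sum, Finset.sum_mul_sum]
    simp only [star_dotStar]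
  rw [hS, hF]
  -- Orthonormality of the rows leaves one free index fewer than four in each of the two unmixed
  -- sums.
  have hI : ∑ x : (Fin d × Fin d) × (Fin d × Fin d),
      (if (x.1.1, x.2.1) = (x.1.2, x.2.1) then (1 : ℂ) else 0) *
        (if (x.1.2, x.2.2) = (x.1.1, x.2.2) then (1 : ℂ) else 0) = (d : ℂ) ^ 3 := by
    simp [Fintype.sum_prod_type]
    ring
  have hJ : ∑ x : (Fin d × Fin d) × (Fin d × Fin d),
      (if (x.1.1, x.2.1) = (x.1.1, x.2.2) then (1 : ℂ) else 0) *
        (if (x.1.2, x.2.2) = (x.1.2, x.2.1) then (1 : ℂ) else 0) = (d : ℂ) ^ 3 := by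
    simp [Fintype.sum_prod_type]
    ring
  rw [hI, hJ]
  ring

/-- The entangling power of a unitary in terms of its regrouped Gram matrices. -/
theorem entanglingPower_eq {d : ℕ} (hd : 0 < d)
    {U : Matrix (Fin d × Fin d) (Fin d × Fin d) ℂ}
    (hU : U ∈ Matrix.unitaryGroup (Fin d × Fin d) ℂ) :
    entanglingPower U = (d : ℝ) / ((d : ℝ) - 1) *
      (1 - (2 * (d : ℝ) ^ 3 + sumNormSq (gramSnd U) + sumNormSq (gramFst U)) /
        ((d : ℝ) * (d + 1)) ^ 2) := by
  have := isProbabilityMeasure_sphereProb hd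
  have hc : ∀ (x : (Fin d × Fin d) × (Fin d × Fin d)) (ψ₁ : EuclideanSpace ℂ (Fin d)),
      Continuous fun ψ₂ : Metric.sphere (0 : EuclideanSpace ℂ (Fin d)) 1 =>
      quarticForm (U (x.1.1, x.2.1)) (U (x.1.2, x.2.1)) (U (x.1.2, x.2.2)) (U (x.1.1, x.2.2))
        ψ₁ ψ₂.1 := by
    intro x ψ₁
    unfold quarticForm bilForm
    fun_prop
  have hc' : ∀ x : (Fin d × Fin d) × (Fin d × Fin d),
      Continuous fun ψ₁ : Metric.sphere (0 : EuclideanSpace ℂ (Fin d)) 1 =>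
      ∫ ψ₂, quarticForm (U (x.1.1, x.2.1)) (U (x.1.2, x.2.1)) (U (x.1.2, x.2.2))
        (U (x.1.1, x.2.2)) ψ₁.1 ψ₂.1 ∂(sphereProb d) := fun x =>
    (continuous_integral_quarticForm _ _ _ _).comp continuous_subtype_val
  have hmean : ∀ f : Metric.sphere (0 : EuclideanSpace ℂ (Fin d)) 1 → ℂ, Continuous f →
      ∫ ψ, (1 - (f ψ).re) ∂(sphereProb d) = 1 - (∫ ψ, f ψ ∂(sphereProb d)).re := by
    intro f hf
    have hre : ∫ ψ, (f ψ).re ∂(sphereProb d) = (∫ ψ, f ψ ∂(sphereProb d)).re :=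
      integral_re (integrable_sphereProb hf)
    rw [integral_sub (integrable_const _) (integrable_sphereProb (by fun_prop)), hre]
    simp
  unfold entanglingPower linearEntropy
  simp_rw [trace_reducedDensity_sq, integral_const_mul]
  congr 1
  rw [integral_congr_ae (Filter.Eventually.of_forall fun ψ₁ => hmean _
    (continuous_finsetSum _ fun x _ => hc x ψ₁.1))]
  simp_rw [fun ψ₁ : Metric.sphere (0 : EuclideanSpace ℂ (Fin d)) 1 =>
    integral_sum_sphereProb (fun x => hc x ψ₁.1)]
  rw [hmean _ (continuous_finsetSum _ fun x _ => hc' x), integral_sum_sphereProb hc',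
    integral_trace_reducedDensity_sq hd hU, Complex.ofReal_re]

/-- Isolates the two nonnegative excesses over `d²`, from which both the bound and its equality case
can be read. -/
lemma entanglingPower_eq_sub {d : ℕ} (hd : 2 ≤ d)
    {U : Matrix (Fin d × Fin d) (Fin d × Fin d) ℂ}
    (hU : U ∈ Matrix.unitaryGroup (Fin d × Fin d) ℂ) :
    entanglingPower U = (d : ℝ) / ((d : ℝ) + 1) -
      ((sumNormSq (gramSnd U) - (d : ℝ) ^ 2) + (sumNormSq (gramFst U) - (d : ℝ) ^ 2)) /
        (((d : ℝ) - 1) * d * ((d : ℝ) + 1) ^ 2) := by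
  have h2 : (2 : ℝ) ≤ d := by exact_mod_cast hd
  have h0 : (d : ℝ) ≠ 0 := by positivity
  have h1 : (d : ℝ) - 1 ≠ 0 := by linarith
  have h3 : (d : ℝ) + 1 ≠ 0 := by positivity
  rw [entanglingPower_eq (by omega) hU]
  field_simp
  ring

/-- The entangling power of a unitary is at most `d / (d + 1)`. -/
theorem entanglingPower_le {d : ℕ} (hd : 2 ≤ d)
    {U : Matrix (Fin d × Fin d) (Fin d × Fin d) ℂ}
    (hU : U ∈ Matrix.unitaryGroup (Fin d × Fin d) ℂ) :
    entanglingPower U ≤ (d : ℝ) / ((d : ℝ) + 1) := by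
  have h2 : (2 : ℝ) ≤ d := by exact_mod_cast hd
  rw [entanglingPower_eq_sub hd hU]
  have hS := sq_le_sumNormSq_of_trace (by omega) (trace_gramSnd hU)
  have hF := sq_le_sumNormSq_of_trace (by omega) (trace_gramFst hU)
  have h4 : 0 ≤ ((sumNormSq (gramSnd U) - (d : ℝ) ^ 2) + (sumNormSq (gramFst U) - (d : ℝ) ^ 2)) /
        (((d : ℝ) - 1) * d * ((d : ℝ) + 1) ^ 2) :=
    div_nonneg (by linarith) (mul_nonneg (mul_nonneg (by linarith) (by linarith)) (by positivity))
  linarith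

theorem entanglingPower_eq_max_iff {d : ℕ} (hd : 2 ≤ d)
    {U : Matrix (Fin d × Fin d) (Fin d × Fin d) ℂ}
    (hU : U ∈ Matrix.unitaryGroup (Fin d × Fin d) ℂ) :
    entanglingPower U = (d : ℝ) / ((d : ℝ) + 1) ↔
      sumNormSq (gramSnd U) = (d : ℝ) ^ 2 ∧ sumNormSq (gramFst U) = (d : ℝ) ^ 2 := by
  have h2 : (2 : ℝ) ≤ d := by exact_mod_cast hd
  rw [entanglingPower_eq_sub hd hU]
  have hS := sq_le_sumNormSq_of_trace (by omega) (trace_gramSnd hU)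
  have hF := sq_le_sumNormSq_of_trace (by omega) (trace_gramFst hU)
  have h1 : (d : ℝ) - 1 ≠ 0 := by linarith
  rw [sub_eq_self, div_eq_zero_iff]
  have h5 : ((d : ℝ) - 1) * d * ((d : ℝ) + 1) ^ 2 ≠ 0 := by positivity
  constructor
  · rintro (h | h)
    · constructor <;> linarith
    · exact absurd h h5
  · rintro ⟨h, h'⟩
    left
    linarith

/-! ### Permutation matrices: counting, Latin squares and the four conditions -/

/-- The number of quadruples `(i, j, m, n)` with `l i m = l j m`, `l i n = l j n`,
`k i m = k i n`, `k j m = k j n`. -/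
def overlapCount {d : ℕ} (k l : Fin d → Fin d → Fin d) : ℕ :=
  ∑ i, ∑ j, ∑ m, ∑ n, (if l i m = l j m then 1 else 0) * (if l i n = l j n then 1 else 0) *
    (if k i m = k i n then 1 else 0) * (if k j m = k j n then 1 else 0)

/-- The diagonal quadruples `i = j`, `m = n` are always counted and number `d²`. A repetition in a
row of `k` gives an extra quadruple with `i = j`, one in a column of `l` an extra one with `m = n`;
without repetitions the constraints force both equalities. -/
lemma overlapCount_eq_sq_iff {d : ℕ} (k l : Fin d → Fin d → Fin d) :
    overlapCount k l = d ^ 2 ↔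
      (∀ i, Function.Injective (k i)) ∧ ∀ m, Function.Injective fun i => l i m := by
  have hsum : overlapCount k l = ((Finset.univ : Finset ((Fin d × Fin d) × (Fin d × Fin d))).filter
      fun z => l z.1.1 z.2.1 = l z.1.2 z.2.1 ∧ l z.1.1 z.2.2 = l z.1.2 z.2.2 ∧
        k z.1.1 z.2.1 = k z.1.1 z.2.2 ∧ k z.1.2 z.2.1 = k z.1.2 z.2.2).card := by
    rw [Finset.card_filter]
    simp only [overlapCount, Fintype.sum_prod_type]
    refine Finset.sum_congr rfl fun i _ => Finset.sum_congr rfl fun j _ =>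
      Finset.sum_congr rfl fun m _ => Finset.sum_congr rfl fun n _ => ?_
    split_ifs <;> simp_all
  have hdiag : ((Finset.univ : Finset ((Fin d × Fin d) × (Fin d × Fin d))).filter
      fun z => z.1.1 = z.1.2 ∧ z.2.1 = z.2.2).card = d ^ 2 := by
    have : (Finset.univ : Finset (Fin d × Fin d)).card = d ^ 2 := by simp [pow_two]
    rw [← this]
    refine (Finset.card_bij (fun x _ => ((x.1, x.1), (x.2, x.2))) ?_ ?_ ?_).symm
    · simp
    · rintro ⟨i, m⟩ - ⟨j, n⟩ - h
      simpa using h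
    · rintro ⟨⟨i, j⟩, ⟨m, n⟩⟩ h
      simp only [Finset.mem_filter, Finset.mem_univ, true_and] at h
      obtain ⟨rfl, rfl⟩ := h
      exact ⟨(i, m), Finset.mem_univ _, rfl⟩
  have hsub : ((Finset.univ : Finset ((Fin d × Fin d) × (Fin d × Fin d))).filter
      fun z => z.1.1 = z.1.2 ∧ z.2.1 = z.2.2) ⊆
      ((Finset.univ : Finset ((Fin d × Fin d) × (Fin d × Fin d))).filter
      fun z => l z.1.1 z.2.1 = l z.1.2 z.2.1 ∧ l z.1.1 z.2.2 = l z.1.2 z.2.2 ∧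
        k z.1.1 z.2.1 = k z.1.1 z.2.2 ∧ k z.1.2 z.2.1 = k z.1.2 z.2.2) := by
    rintro ⟨⟨i, j⟩, ⟨m, n⟩⟩ h
    simp only [Finset.mem_filter, Finset.mem_univ, true_and] at h ⊢
    obtain ⟨rfl, rfl⟩ := h
    simp
  rw [hsum, ← hdiag]
  constructor
  · intro h
    have heq := Finset.eq_of_subset_of_card_le hsub h.le
    constructor
    · intro i m n hmn
      have : ((i, i), (m, n)) ∈ ((Finset.univ : Finset ((Fin d × Fin d) × (Fin d × Fin d))).filter
          fun z => z.1.1 = z.1.2 ∧ z.2.1 = z.2.2) := by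
        rw [heq]; simp [hmn]
      simpa using this
    · intro m i j hij
      have : ((i, j), (m, m)) ∈ ((Finset.univ : Finset ((Fin d × Fin d) × (Fin d × Fin d))).filter
          fun z => z.1.1 = z.1.2 ∧ z.2.1 = z.2.2) := by
        rw [heq]; simpa using hij
      simpa using this
  · rintro ⟨hk, hl⟩
    congr 1
    ext ⟨⟨i, j⟩, ⟨m, n⟩⟩
    simp only [Finset.mem_filter, Finset.mem_univ, true_and]
    constructor
    · rintro ⟨h1, -, h3, -⟩
      exact ⟨hl m h1, hk i h3⟩
    · rintro ⟨rfl, rfl⟩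
      simp

lemma ite_and_eq_mul (a b : Prop) [Decidable a] [Decidable b] :
    (if a ∧ b then (1 : ℂ) else 0) = (if a then 1 else 0) * (if b then 1 else 0) := by
  split_ifs <;> simp_all

/-- Each entry of `N` is a count, so its square is a sum over pairs `(i, j)`; summing out the labels
`p.1` and `q.1` leaves the coincidences of `l`. -/
lemma sumNormSq_eq_overlapCount {d : ℕ} (k l : Fin d → Fin d → Fin d)
    (N : Matrix (Fin d × Fin d) (Fin d × Fin d) ℂ)
    (hN : ∀ p q, N p q = ∑ m, (if l m p.2 = p.1 then 1 else 0) * (if l m q.2 = q.1 then 1 else 0) *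
      (if k m p.2 = k m q.2 then 1 else 0)) :
    sumNormSq N = overlapCount k l := by
  have h : (sumNormSq N : ℂ) = ∑ p, ∑ q, N p q * star (N p q) := by
    simp only [sumNormSq, Complex.ofReal_sum, Complex.ofReal_pow]
    refine Finset.sum_congr rfl fun p _ => Finset.sum_congr rfl fun q _ => ?_
    exact (Complex.mul_conj' _).symm
  have h2 : ∀ p q, N p q * star (N p q) = ∑ i, ∑ j,
      (if l i p.2 = p.1 ∧ l j p.2 = p.1 then 1 else 0) *
      (if l i q.2 = q.1 ∧ l j q.2 = q.1 then 1 else 0) *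
      ((if k i p.2 = k i q.2 then 1 else 0) * (if k j p.2 = k j q.2 then 1 else 0)) := by
    intro p q
    rw [hN, star_sum, Finset.sum_mul_sum]
    refine Finset.sum_congr rfl fun i _ => Finset.sum_congr rfl fun j _ => ?_
    simp only [star_mul', apply_ite star, star_one, star_zero, ite_and_eq_mul]
    ring
  have h3 : ∑ p, ∑ q, N p q * star (N p q) = ∑ i, ∑ j, ∑ m, ∑ n,
      ∑ s, ∑ t, (if l i m = s ∧ l j m = s then (1 : ℂ) else 0) *
      (if l i n = t ∧ l j n = t then 1 else 0) *
      ((if k i m = k i n then 1 else 0) * (if k j m = k j n then 1 else 0)) := by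
    simp_rw [h2]
    let e : ((((Fin d × Fin d) × (Fin d × Fin d)) × (Fin d × Fin d))) ≃
        ((((Fin d × Fin d) × (Fin d × Fin d)) × (Fin d × Fin d))) :=
      { toFun := fun z => ((z.2, (z.1.1.2, z.1.2.2)), (z.1.1.1, z.1.2.1))
        invFun := fun z => (((z.2.1, z.1.2.1), (z.2.2, z.1.2.2)), z.1.1)
        left_inv := fun _ => rfl
        right_inv := fun _ => rfl }
    have := Fintype.sum_equiv e
      (fun z => (if l z.2.1 z.1.1.2 = z.1.1.1 ∧ l z.2.2 z.1.1.2 = z.1.1.1 then (1 : ℂ) else 0) *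
      (if l z.2.1 z.1.2.2 = z.1.2.1 ∧ l z.2.2 z.1.2.2 = z.1.2.1 then 1 else 0) *
      ((if k z.2.1 z.1.1.2 = k z.2.1 z.1.2.2 then 1 else 0) *
        (if k z.2.2 z.1.1.2 = k z.2.2 z.1.2.2 then 1 else 0)))
      (fun z => (if l z.1.1.1 z.1.2.1 = z.2.1 ∧ l z.1.1.2 z.1.2.1 = z.2.1 then (1 : ℂ) else 0) *
      (if l z.1.1.1 z.1.2.2 = z.2.2 ∧ l z.1.1.2 z.1.2.2 = z.2.2 then 1 else 0) *
      ((if k z.1.1.1 z.1.2.1 = k z.1.1.1 z.1.2.2 then 1 else 0) *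
        (if k z.1.1.2 z.1.2.1 = k z.1.1.2 z.1.2.2 then 1 else 0)))
      fun _ => rfl
    simpa only [Fintype.sum_prod_type] using this
  have h4 : ∀ i j m, ∑ s, (if l i m = s ∧ l j m = s then (1 : ℂ) else 0) =
      if l i m = l j m then 1 else 0 := by
    intro i j m
    simp only [ite_and, Finset.sum_ite_eq, Finset.mem_univ, if_true]
    simp only [eq_comm]
  have h5 : (sumNormSq N : ℂ) = overlapCount k l := by
    rw [h, h3, overlapCount]
    push_cast
    refine Finset.sum_congr rfl fun i _ => Finset.sum_congr rfl fun j _ =>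
      Finset.sum_congr rfl fun m _ => Finset.sum_congr rfl fun n _ => ?_
    rw [← h4, ← h4, Finset.sum_mul_sum, Finset.sum_mul, Finset.sum_mul]
    refine Finset.sum_congr rfl fun s _ => ?_
    rw [Finset.sum_mul, Finset.sum_mul]
    refine Finset.sum_congr rfl fun t _ => by ring
  exact_mod_cast h5

lemma permOp_mem_unitaryGroup {d : ℕ} (p : Equiv.Perm (Fin d × Fin d)) :
    permOp p ∈ Matrix.unitaryGroup (Fin d × Fin d) ℂ := by
  rw [Matrix.mem_unitaryGroup_iff]
  ext x y
  simp only [Matrix.mul_apply, permOp, Matrix.of_apply, Matrix.star_apply, Matrix.one_apply]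
  rw [Fintype.sum_eq_single (p.symm x)]
  · simp [eq_comm]
  · intro z hz
    rw [if_neg, zero_mul]
    rintro rfl
    simp at hz

lemma gramSnd_permOp {d : ℕ} (p : Equiv.Perm (Fin d × Fin d)) :
    sumNormSq (gramSnd (permOp p)) =
      overlapCount (fun i j => (p (i, j)).1) (fun i j => (p (i, j)).2) := by
  refine sumNormSq_eq_overlapCount _ _ _ fun x y => ?_
  simp only [gramSnd, permOp, Matrix.of_apply]
  rw [Finset.sum_comm]
  refine Finset.sum_congr rfl fun m _ => ?_
  rw [Fintype.sum_eq_single (p (m, x.2)).1]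
  · simp only [Prod.ext_iff]
    split_ifs <;> simp_all
  · intro i hi
    rw [if_neg, zero_mul]
    intro h
    exact hi (congrArg Prod.fst h)

lemma gramFst_permOp {d : ℕ} (p : Equiv.Perm (Fin d × Fin d)) :
    sumNormSq (gramFst (permOp p)) =
      overlapCount (fun i j => (p (i, j)).2) (fun i j => (p (i, j)).1) := by
  refine sumNormSq_eq_overlapCount _ _ _ fun x y => ?_
  simp only [gramFst, permOp, Matrix.of_apply]
  rw [Finset.sum_comm]
  refine Finset.sum_congr rfl fun m _ => ?_
  rw [Fintype.sum_eq_single (p (m, x.2)).2]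
  · simp only [Prod.ext_iff]
    split_ifs <;> simp_all
  · intro i hi
    rw [if_neg, zero_mul]
    intro h
    exact hi (congrArg Prod.snd h)

/-- Both coordinates of `p` are Latin squares. -/
def IsLatinPair {d : ℕ} (p : Equiv.Perm (Fin d × Fin d)) : Prop :=
  ((∀ i, Function.Injective fun j => (p (i, j)).1) ∧
    ∀ j, Function.Injective fun i => (p (i, j)).2) ∧
  ((∀ i, Function.Injective fun j => (p (i, j)).2) ∧
    ∀ j, Function.Injective fun i => (p (i, j)).1)

lemma entanglingPower_permOp_eq_max_iff {d : ℕ} (hd : 2 ≤ d) (p : Equiv.Perm (Fin d × Fin d)) :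
    entanglingPower (permOp p) = (d : ℝ) / ((d : ℝ) + 1) ↔ IsLatinPair p := by
  rw [entanglingPower_eq_max_iff hd (permOp_mem_unitaryGroup p), gramSnd_permOp, gramFst_permOp,
    IsLatinPair, ← overlapCount_eq_sq_iff fun i j => (p (i, j)).1,
    ← overlapCount_eq_sq_iff fun i j => (p (i, j)).2]
  norm_cast

/-- `Q` unfolds to `overlapCount`. Composing with the swap transposes both arrays, so `Q_PS`
controls the columns of `k` and the rows of `l`. -/
lemma Q_eq_sq_iff_isLatinPair {d : ℕ} (p : Equiv.Perm (Fin d × Fin d)) :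
    (Q p = d ^ 2 ∧ Q (p * swapPerm d) = d ^ 2) ↔ IsLatinPair p := by
  have h1 : ∀ q : Equiv.Perm (Fin d × Fin d),
      Q q = overlapCount (fun i j => (q (i, j)).1) (fun i j => (q (i, j)).2) := fun _ => rfl
  rw [h1, h1, overlapCount_eq_sq_iff, overlapCount_eq_sq_iff]
  have h2 : ∀ i j, (p * swapPerm d) (i, j) = p (j, i) := fun _ _ => rfl
  simp only [h2, IsLatinPair]
  tauto

/-- Condition 1 corresponds to the rows of `k`, 3 to the columns of `k`, and 4 to the rows of `l`.
Given condition 1, condition 2 corresponds to the columns of `l`. -/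
lemma fourConditions_permOp_iff {d : ℕ} (p : Equiv.Perm (Fin d × Fin d)) :
    FourConditions (permOp p) ↔ IsLatinPair p := by
  have hne : ∀ k i l j, block (permOp p) k i l j ≠ 0 ↔ p (i, j) = (k, l) := by
    intro k i l j
    simp [block, permOp, eq_comm]
  constructor
  · rintro ⟨h1, h2, h3, h4⟩
    have hrow : ∀ i, Function.Injective fun j => (p (i, j)).1 := by
      intro i j j' h
      have := (h1 (p (i, j)).1 i).unique (y₁ := ((p (i, j)).2, j)) (y₂ := ((p (i, j')).2, j'))
        ((hne _ _ _ _).2 rfl) ((hne _ _ _ _).2 (Prod.ext h.symm rfl))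
      exact congrArg Prod.snd this
    refine ⟨⟨hrow, ?_⟩, ?_, ?_⟩
    · intro j i i' h
      simp only at h
      by_contra hii
      refine h2 (p (i, j)).1 i (p (i', j)).1 i' (fun h => hii (congrArg Prod.snd h)) ?_
      -- If `l` repeats in column `j`, the two blocks concerned have their only nonzero entry at the
      -- same place, hence coincide, against condition 2.
      have huniq : ∀ a, (p (a, j)).2 = (p (i, j)).2 → ∀ l' j',
          p (a, j') = ((p (a, j)).1, l') ↔ l' = (p (i, j)).2 ∧ j' = j := by
        intro a ha l' j'
        constructor
        · intro h
          have : j' = j := hrow a (congrArg Prod.fst h :)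
          subst this
          exact ⟨((congrArg Prod.snd h).symm.trans ha :), rfl⟩
        · rintro ⟨rfl, rfl⟩
          exact Prod.ext rfl ha
      ext l' j'
      simp only [block, permOp, Matrix.of_apply]
      exact if_congr (eq_comm.trans ((huniq i rfl l' j').trans
        ((huniq i' h.symm l' j').symm.trans eq_comm))) rfl rfl
    · intro i j j' h
      by_contra hjj
      exact h4 i (p (i, j)).1 (p (i, j)).2 j (p (i, j')).1 (p (i, j')).2 j' ((hne _ _ _ _).2 rfl)
        ((hne _ _ _ _).2 rfl) (by simp [hjj]) h
    · intro j i i' h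
      by_contra hii
      exact h3 (p (i, j)).1 i (p (i, j)).2 j i' (p (i', j)).2 j ((hne _ _ _ _).2 rfl)
        ((hne _ _ _ _).2 (Prod.ext h.symm rfl)) (by simp [hii]) rfl
  · rintro ⟨⟨hk, hl⟩, hl', hk'⟩
    have h1 : OneEntryPerBlock (permOp p) := by
      intro k i
      obtain ⟨j, hj⟩ := (Finite.injective_iff_surjective.1 (hk i)) k
      refine ⟨((p (i, j)).2, j), (hne _ _ _ _).2 (Prod.ext hj rfl), ?_⟩
      rintro ⟨l', j'⟩ h
      rw [hne] at h
      have : j' = j := hk i ((congrArg Prod.fst h).trans hj.symm)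
      subst this
      exact Prod.ext (congrArg Prod.snd h).symm rfl
    refine ⟨h1, ?_, ?_, ?_⟩
    · intro k i k' i' hki heq
      obtain ⟨⟨l, j⟩, h, -⟩ := h1 k i
      have h' := h
      simp only [heq] at h'
      rw [hne] at h h'
      have : i = i' := hl j (by simp [h, h'])
      subst this
      rw [h] at h'
      exact hki (by simp_all)
    · intro k i l j i' l' j' h h' hn hj
      rw [hne] at h h'
      subst hj
      have : i = i' := hk' j (by simp [h, h'])
      subst this
      rw [h] at h'
      simp_all
    · intro i k l j k' l' j' h h' hn hl
      rw [hne] at h h'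
      subst hl
      have : j = j' := hl' i (by simp [h, h'])
      subst this
      rw [h] at h'
      simp_all

/-! ### Orthogonal arrays from rings and products -/

/-- A set of rows is an orthogonal array (of strength two and index one) if any two entries at
two different positions determine a unique row. -/
def IsOA {ι X : Type*} (A : Set (ι → X)) : Prop :=
  ∀ i j, i ≠ j → ∀ a b, ∃! w, w ∈ A ∧ w i = a ∧ w j = b

lemma IsOA.exists_row {ι X : Type*} {A : Set (ι → X)} (h : IsOA A) {i j : ι} (hij : i ≠ j)
    (a b : X) : ∃ w ∈ A, w i = a ∧ w j = b := (h i j hij a b).exists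

lemma IsOA.eq_of {ι X : Type*} {A : Set (ι → X)} (h : IsOA A) {i j : ι} (hij : i ≠ j)
    {v w : ι → X} (hv : v ∈ A) (hw : w ∈ A) (h1 : v i = w i) (h2 : v j = w j) : v = w :=
  (h i j hij (w i) (w j)).unique ⟨hv, h1, h2⟩ ⟨hw, rfl, rfl⟩

lemma isOA_of {ι X : Type*} {A : Set (ι → X)}
    (h : ∀ i j, i ≠ j → ∀ a b, ∃ w ∈ A, w i = a ∧ w j = b)
    (h' : ∀ i j, i ≠ j → ∀ v ∈ A, ∀ w ∈ A, v i = w i → v j = w j → v = w) : IsOA A := by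
  intro i j hij a b
  obtain ⟨w, hw, h1, h2⟩ := h i j hij a b
  exact ⟨w, ⟨hw, h1, h2⟩, fun v ⟨hv, h3, h4⟩ =>
    h' i j hij v hv w hw (h3.trans h1.symm) (h4.trans h2.symm)⟩

lemma IsOA.image_equiv {ι X Y : Type*} {A : Set (ι → X)} (h : IsOA A) (e : X ≃ Y) :
    IsOA ((fun w => e ∘ w) '' A) := by
  refine isOA_of ?_ ?_
  · intro i j hij a b
    obtain ⟨w, hw, h1, h2⟩ := h.exists_row hij (e.symm a) (e.symm b)
    exact ⟨_, ⟨w, hw, rfl⟩, by simp [h1], by simp [h2]⟩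
  · rintro i j hij _ ⟨v, hv, rfl⟩ _ ⟨w, hw, rfl⟩ h1 h2
    rw [h.eq_of hij hv hw (e.injective h1) (e.injective h2)]

/-- There is an orthogonal array with four columns on `n` symbols, that is, a pair of orthogonal
Latin squares of order `n`. -/
def HasOA (n : ℕ) : Prop := ∃ A : Set (Fin 4 → Fin n), IsOA A

lemma IsOA.hasOA {X : Type*} [Fintype X] {A : Set (Fin 4 → X)} (h : IsOA A) {n : ℕ}
    (hn : Fintype.card X = n) : HasOA n :=
  ⟨_, h.image_equiv (Fintype.equivFinOfCardEq hn)⟩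

/-- The rows `i ↦ α i * x + β i * y`. -/
def linearRows {ι R : Type*} [CommRing R] (α β : ι → R) : Set (ι → R) :=
  Set.range fun z : R × R => fun i => α i * z.1 + β i * z.2

lemma zero_mem_linearRows {ι R : Type*} [CommRing R] (α β : ι → R) :
    (fun _ => 0) ∈ linearRows α β := ⟨(0, 0), by simp⟩

/-- Two columns determine `(x, y)` by Cramer's rule, the determinant being a unit. -/
lemma isOA_linearRows {ι R : Type*} [CommRing R] {α β : ι → R}
    (h : ∀ i j, i ≠ j → IsUnit (α i * β j - α j * β i)) : IsOA (linearRows α β) := by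
  refine isOA_of ?_ ?_
  · intro i j hij a b
    obtain ⟨u, hu⟩ := (h i j hij).exists_right_inv
    refine ⟨_, ⟨(u * (β j * a - β i * b), u * (α i * b - α j * a)), rfl⟩, ?_, ?_⟩
    · linear_combination a * hu
    · linear_combination b * hu
  · rintro i j hij _ ⟨⟨x, y⟩, rfl⟩ _ ⟨⟨x', y'⟩, rfl⟩ h1 h2
    simp only at h1 h2
    have hx : x = x' := (h i j hij).mul_left_cancel (by
      linear_combination β j * h1 - β i * h2)
    have hy : y = y' := (h i j hij).mul_left_cancel (by
      linear_combination α i * h2 - α j * h1)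
    rw [hx, hy]

lemma isOA_four {R : Type*} [CommRing R] {c : R} (h : IsUnit c) (h' : IsUnit (c - 1)) :
    IsOA (linearRows ![0, 1, 1, 1] ![1, 0, 1, c]) := by
  refine isOA_linearRows fun i j hij => ?_
  have h'' : IsUnit (1 - c) := by simpa using h'.neg
  fin_cases i <;> fin_cases j <;> simp_all

/-- Five columns, of slopes `∞, 0, 1, 2, 3`: the determinants are, up to sign, `1`, `2` and `3`. The
extra column is the one truncated in Wilson's construction. -/
lemma isOA_option_four {R : Type*} [CommRing R] (h2 : IsUnit (2 : R)) (h3 : IsUnit (3 : R)) :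
    IsOA (linearRows (fun o : Option (Fin 4) => o.elim (0 : R) fun _ => 1)
      (fun o => o.elim 1 fun i => (i.val : R))) := by
  refine isOA_linearRows fun i j hij => ?_
  have e1 : (1 : R) - 2 = -1 := by ring
  have e2 : (1 : R) - 3 = -2 := by ring
  have e3 : (2 : R) - 3 = -1 := by ring
  have e4 : (2 : R) - 1 = 1 := by ring
  have e5 : (3 : R) - 1 = 2 := by ring
  have e6 : (3 : R) - 2 = 1 := by ring
  rcases i with _ | i <;> rcases j with _ | j
  · simp at hij
  · simp
  · simp
  · fin_cases i <;> fin_cases j <;> simp_all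

lemma IsOA.prod {ι X Y : Type*} {A : Set (ι → X)} {B : Set (ι → Y)} (hA : IsOA A)
    (hB : IsOA B) : IsOA {w : ι → X × Y | Prod.fst ∘ w ∈ A ∧ Prod.snd ∘ w ∈ B} := by
  refine isOA_of ?_ ?_
  · rintro i j hij ⟨a, a'⟩ ⟨b, b'⟩
    obtain ⟨v, hv, h1, h2⟩ := hA.exists_row hij a b
    obtain ⟨w, hw, h3, h4⟩ := hB.exists_row hij a' b'
    exact ⟨fun i => (v i, w i), ⟨hv, hw⟩, by simp [h1, h3], by simp [h2, h4]⟩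
  · rintro i j hij v ⟨hv, hv'⟩ w ⟨hw, hw'⟩ h1 h2
    have e1 := hA.eq_of hij hv hw (congrArg Prod.fst h1) (congrArg Prod.fst h2)
    have e2 := hB.eq_of hij hv' hw' (congrArg Prod.snd h1) (congrArg Prod.snd h2)
    funext i
    exact Prod.ext (congrFun e1 i) (congrFun e2 i)

lemma HasOA.mul {m n : ℕ} (hm : HasOA m) (hn : HasOA n) : HasOA (m * n) := by
  obtain ⟨A, hA⟩ := hm
  obtain ⟨B, hB⟩ := hn
  exact (hA.prod hB).hasOA (by simp)

lemma hasOA_of_odd {n : ℕ} (h : Odd n) : HasOA n := by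
  have : NeZero n := ⟨by rintro rfl; simp at h⟩
  have h2 : IsUnit (2 : ZMod n) := by
    have := (ZMod.isUnit_iff_coprime 2 n).2 (Nat.coprime_two_left.2 h)
    exact_mod_cast this
  have h1 : IsUnit ((2 : ZMod n) - 1) := by
    rw [show (2 : ZMod n) - 1 = 1 by ring]
    exact isUnit_one
  exact (isOA_four h2 h1).hasOA (ZMod.card n)

lemma exists_isOA_galoisField {k : ℕ} (hk : 2 ≤ k) :
    ∃ A : Set (Fin 4 → GaloisField 2 k), IsOA A ∧ (fun _ => 0) ∈ A := by
  have hcard : 2 < Nat.card (GaloisField 2 k) := by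
    rw [GaloisField.card 2 k (by omega)]
    calc 2 < 2 ^ 2 := by norm_num
      _ ≤ 2 ^ k := Nat.pow_le_pow_right (by norm_num) hk
  classical
  have := Fintype.ofFinite (GaloisField 2 k)
  rw [Nat.card_eq_fintype_card] at hcard
  obtain ⟨c, hc⟩ := Finset.exists_mem_notMem_of_card_lt_card
    (s := ({0, 1} : Finset (GaloisField 2 k))) (t := Finset.univ)
    (lt_of_le_of_lt Finset.card_le_two hcard)
  simp only [Finset.mem_univ, Finset.mem_insert, Finset.mem_singleton, true_and, not_or] at hc
  exact ⟨_, isOA_four (Ne.isUnit hc.1) (Ne.isUnit (sub_ne_zero.2 hc.2)), zero_mem_linearRows _ _⟩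

lemma hasOA_two_pow {k : ℕ} (hk : 2 ≤ k) : HasOA (2 ^ k) := by
  obtain ⟨A, hA, -⟩ := exists_isOA_galoisField hk
  have := Fintype.ofFinite (GaloisField 2 k)
  refine hA.hasOA ?_
  rw [← Nat.card_eq_fintype_card, GaloisField.card 2 k (by omega)]

/-! ### Wilson's construction -/

/-- Symbols over `t`, with the symbol at infinity replaced by `h`. -/
def glue {T M U : Type*} (t : T) (h : U) : Option M → (T × M) ⊕ U
  | some m => Sum.inl (t, m)
  | none => Sum.inr h

/-- The rows of Wilson's construction: an array with an extra column, whose symbols in the range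
of `e` are kept, is inflated by arrays on `M` and on `Option M`, and the hole is filled. -/
def wilsonRows {ι T M U : Type*} (A : Set (Option ι → T)) (AM : Set (ι → M))
    (AO : Set (ι → Option M)) (AU : Set (ι → U)) (e : U → T) : Set (ι → (T × M) ⊕ U) :=
  {w | (∃ B ∈ A, B none ∉ Set.range e ∧ ∃ v ∈ AM, w = fun i => Sum.inl (B (some i), v i)) ∨
    (∃ B ∈ A, ∃ h, B none = e h ∧ ∃ v ∈ AO, v ≠ (fun _ => none) ∧
      w = fun i => glue (B (some i)) h (v i)) ∨
    ∃ v ∈ AU, w = fun i => Sum.inr (v i)}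

lemma glue_eq_inl {T M U : Type*} {t t' : T} {h : U} {o : Option M} {m : M} :
    glue t h o = Sum.inl (t', m) ↔ t = t' ∧ o = some m := by
  cases o <;> simp [glue]

lemma glue_eq_inr {T M U : Type*} {t : T} {h h' : U} {o : Option M} :
    glue t h o = Sum.inr h' ↔ h = h' ∧ o = none := by
  cases o <;> simp [glue]

/-- Two finite symbols over `t, t'` determine a row `B` of `A`, and whether its extra entry is kept
decides if `AM` or `AO` supplies the rest. A finite and an infinite symbol determine `B` through the
extra column, then a row of `AO`. Two infinite symbols occur together only in `AU`, because the
all-`none` row of `AO` is removed. -/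
lemma isOA_wilsonRows {ι T M U : Type*} {A : Set (Option ι → T)} {AM : Set (ι → M)}
    {AO : Set (ι → Option M)} {AU : Set (ι → U)} {e : U → T} (he : Function.Injective e)
    (hA : IsOA A) (hM : IsOA AM) (hO : IsOA AO) (hU : IsOA AU) (hnone : (fun _ => none) ∈ AO) :
    IsOA (wilsonRows A AM AO AU e) := by
  have hmixed : ∀ i j, i ≠ j → ∀ (x : T × M) (h : U), ∃! w, w ∈ wilsonRows A AM AO AU e ∧
      w i = Sum.inl x ∧ w j = Sum.inr h := by
    rintro i j hij ⟨t, m⟩ h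
    obtain ⟨B, hB, hB1, hB2⟩ := hA.exists_row (i := some i) (j := none) (by simp) t (e h)
    obtain ⟨v, hv, hv1, hv2⟩ := hO.exists_row hij (some m) none
    refine ⟨fun i => glue (B (some i)) h (v i), ⟨Or.inr (Or.inl ⟨B, hB, h, hB2, v, hv, ?_, rfl⟩),
      ?_, ?_⟩, ?_⟩
    · rintro rfl
      simp at hv1
    · rw [glue_eq_inl]; exact ⟨hB1, hv1⟩
    · rw [glue_eq_inr]; exact ⟨rfl, hv2⟩
    · rintro w ⟨⟨B', hB', hr, v', hv', rfl⟩ | ⟨B', hB', h', hBh, v', hv', hvn, rfl⟩ |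
        ⟨v', hv', rfl⟩, h1, h2⟩
      · simp at h2
      · rw [glue_eq_inl] at h1
        rw [glue_eq_inr] at h2
        obtain ⟨rfl, h2⟩ := h2
        have e1 : B' = B := hA.eq_of (i := some i) (j := none) (by simp) hB' hB
          (h1.1.trans hB1.symm) (hBh.trans hB2.symm)
        have e2 : v' = v := hO.eq_of hij hv' hv (h1.2.trans hv1.symm) (h2.trans hv2.symm)
        rw [e1, e2]
      · simp at h1
  rintro i j hij (⟨t, m⟩ | h) (⟨t', m'⟩ | h')
  · obtain ⟨B, hB, hB1, hB2⟩ := hA.exists_row (i := some i) (j := some j) (by simpa using hij) t t'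
    have huniq : ∀ B' ∈ A, B' (some i) = t → B' (some j) = t' → B' = B := fun B' hB' h1 h2 =>
      hA.eq_of (i := some i) (j := some j) (by simpa using hij) hB' hB (h1.trans hB1.symm)
        (h2.trans hB2.symm)
    by_cases hr : B none ∈ Set.range e
    · obtain ⟨h, hh⟩ := hr
      obtain ⟨v, hv, hv1, hv2⟩ := hO.exists_row hij (some m) (some m')
      refine ⟨fun i => glue (B (some i)) h (v i), ⟨Or.inr (Or.inl ⟨B, hB, h, hh.symm, v, hv, ?_,
        rfl⟩), ?_, ?_⟩, ?_⟩
      · rintro rfl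
        simp at hv1
      · rw [glue_eq_inl]; exact ⟨hB1, hv1⟩
      · rw [glue_eq_inl]; exact ⟨hB2, hv2⟩
      · rintro w ⟨⟨B', hB', hr, v', hv', rfl⟩ | ⟨B', hB', h', hBh, v', hv', hvn, rfl⟩ |
          ⟨v', hv', rfl⟩, h1, h2⟩
        · simp only [Sum.inl.injEq, Prod.mk.injEq] at h1 h2
          rw [huniq B' hB' h1.1 h2.1] at hr
          exact absurd ⟨h, hh⟩ hr
        · rw [glue_eq_inl] at h1 h2
          have e1 := huniq B' hB' h1.1 h2.1
          have e2 : v' = v := hO.eq_of hij hv' hv (h1.2.trans hv1.symm) (h2.2.trans hv2.symm)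
          have e3 : h' = h := he (by rw [← hBh, e1, hh])
          rw [e1, e2, e3]
        · simp at h1
    · obtain ⟨v, hv, hv1, hv2⟩ := hM.exists_row hij m m'
      refine ⟨fun i => Sum.inl (B (some i), v i), ⟨Or.inl ⟨B, hB, hr, v, hv, rfl⟩, ?_, ?_⟩, ?_⟩
      · simp [hB1, hv1]
      · simp [hB2, hv2]
      · rintro w ⟨⟨B', hB', hr, v', hv', rfl⟩ | ⟨B', hB', h', hBh, v', hv', hvn, rfl⟩ |
          ⟨v', hv', rfl⟩, h1, h2⟩
        · simp only [Sum.inl.injEq, Prod.mk.injEq] at h1 h2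
          have e1 := huniq B' hB' h1.1 h2.1
          have e2 : v' = v := hM.eq_of hij hv' hv (h1.2.trans hv1.symm) (h2.2.trans hv2.symm)
          rw [e1, e2]
        · rw [glue_eq_inl] at h1 h2
          rw [huniq B' hB' h1.1 h2.1] at hBh
          exact absurd ⟨h', hBh.symm⟩ hr
        · simp at h1
  · exact hmixed i j hij (t, m) h'
  · obtain ⟨w, ⟨hw, h1, h2⟩, hu⟩ := hmixed j i hij.symm (t', m') h
    exact ⟨w, ⟨hw, h2, h1⟩, fun w' ⟨hw', h1', h2'⟩ => hu w' ⟨hw', h2', h1'⟩⟩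
  · obtain ⟨v, hv, hv1, hv2⟩ := hU.exists_row hij h h'
    refine ⟨fun i => Sum.inr (v i), ⟨Or.inr (Or.inr ⟨v, hv, rfl⟩), ?_, ?_⟩, ?_⟩
    · simp [hv1]
    · simp [hv2]
    · rintro w ⟨⟨B', hB', hr, v', hv', rfl⟩ | ⟨B', hB', h', hBh, v', hv', hvn, rfl⟩ |
        ⟨v', hv', rfl⟩, h1, h2⟩
      · simp at h1
      · rw [glue_eq_inr] at h1 h2
        exact absurd (hO.eq_of hij hv' hnone h1.2 h2.2) hvn
      · simp only [Sum.inr.injEq] at h1 h2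
        rw [hU.eq_of hij hv' hv (h1.trans hv1.symm) (h2.trans hv2.symm)]

lemma exists_isOA_option_fin_three :
    ∃ A : Set (Fin 4 → Option (Fin 3)), IsOA A ∧ (fun _ => none) ∈ A := by
  obtain ⟨A, hA, h0⟩ := exists_isOA_galoisField le_rfl
  have := Fintype.ofFinite (GaloisField 2 2)
  have hcard : Fintype.card (GaloisField 2 2) = Fintype.card (Option (Fin 3)) := by
    rw [← Nat.card_eq_fintype_card, GaloisField.card 2 2 (by omega)]
    simp
  classical
  -- Sending `0` to `none` turns the zero row of the linear array into the row that Wilson's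
  -- construction discards.
  let e := (Fintype.equivOfCardEq hcard).setValue 0 none
  refine ⟨_, hA.image_equiv e, _, h0, ?_⟩
  funext i
  exact Equiv.setValue_eq _ _ _

lemma hasOA_wilson {t u : ℕ} (ht : Nat.Coprime t 6) (hu : HasOA u) (hut : u ≤ t) :
    HasOA (3 * t + u) := by
  have : NeZero t := ⟨by rintro rfl; simp at ht⟩
  have h2 : IsUnit (2 : ZMod t) := by
    have := (ZMod.isUnit_iff_coprime 2 t).2 (ht.coprime_dvd_right (by norm_num)).symm
    exact_mod_cast this
  have h3 : IsUnit (3 : ZMod t) := by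
    have := (ZMod.isUnit_iff_coprime 3 t).2 (ht.coprime_dvd_right (by norm_num)).symm
    exact_mod_cast this
  obtain ⟨AO, hO, hnone⟩ := exists_isOA_option_fin_three
  obtain ⟨AM, hM⟩ := hasOA_of_odd (n := 3) (by decide)
  obtain ⟨AU, hU⟩ := hu
  let e : Fin u → ZMod t := (ZMod.finEquiv t) ∘ Fin.castLE hut
  have he : Function.Injective e :=
    (ZMod.finEquiv t).injective.comp (Fin.castLE_injective hut)
  refine (isOA_wilsonRows he (isOA_option_four h2 h3) hM hO hU hnone).hasOA ?_
  simp [ZMod.card, mul_comm]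

/-! ### Quasi-difference matrices and the orders 10 and 14 -/

/-- The difference of the entries of a row at the positions `r` and `s`, if they are both
finite. -/
def rowDiff {G H ι : Type*} [Sub G] (b : ι → G ⊕ H) (r s : ι) : Option G :=
  match b r, b s with
  | Sum.inl x, Sum.inl y => some (y - x)
  | _, _ => none

/-- Base rows over `G` with infinite symbols `H` form a quasi-difference matrix. -/
structure IsQuasiDifference {C G H ι : Type*} [Sub G] (b : C → ι → G ⊕ H) : Prop where
  exists_diff : ∀ r s, r ≠ s → ∀ δ : G, ∃ c, rowDiff (b c) r s = some δ
  diff_inj : ∀ r s, r ≠ s → ∀ c c', rowDiff (b c) r s = rowDiff (b c') r s →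
    rowDiff (b c) r s ≠ none → c = c'
  exists_inf : ∀ r, ∀ h : H, ∃ c, b c r = Sum.inr h
  inf_inj : ∀ r c c', b c r = b c' r → (b c r).isRight → c = c'
  inf_finite : ∀ r s, r ≠ s → ∀ c, (b c r).isRight → (b c s).isLeft

/-- The development of base rows, with the hole filled. -/
def developedRows {C G H ι : Type*} [Add G] (b : C → ι → G ⊕ H) (A : Set (ι → H)) :
    Set (ι → G ⊕ H) :=
  {w | (∃ c g, w = fun i => Sum.map (· + g) id (b c i)) ∨ ∃ v ∈ A, w = fun i => Sum.inr (v i)}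

/-- Translation preserves differences and fixes infinite symbols. Two finite symbols thus determine
the base row by their difference and then the translate; an infinite symbol determines the base row,
and the finite one the translate. Two infinite symbols come only from the filled hole. -/
lemma isOA_developedRows {C G H ι : Type*} [AddCommGroup G] {b : C → ι → G ⊕ H}
    {A : Set (ι → H)} (hb : IsQuasiDifference b) (hA : IsOA A) : IsOA (developedRows b A) := by
  have hmixed : ∀ i j, i ≠ j → ∀ (x : G) (h : H), ∃! w, w ∈ developedRows b A ∧
      w i = Sum.inl x ∧ w j = Sum.inr h := by
    intro i j hij x h
    obtain ⟨c, hc⟩ := hb.exists_inf j h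
    obtain ⟨y, hy⟩ := Sum.isLeft_iff.1 (hb.inf_finite j i hij.symm c (by simp [hc]))
    refine ⟨_, ⟨Or.inl ⟨c, x - y, rfl⟩, by simp [hy], by simp [hc]⟩, ?_⟩
    rintro w ⟨⟨c', g, rfl⟩ | ⟨v, hv, rfl⟩, h1, h2⟩
    · have hc' : b c' j = Sum.inr h := by
        rcases hbc : b c' j with z | z <;> simp_all
      have e1 : c' = c := hb.inf_inj j c' c (by rw [hc, hc']) (by simp [hc'])
      subst e1
      have e2 : g = x - y := by
        simp only [hy, Sum.map_inl, Sum.inl.injEq] at h1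
        rw [← h1]; abel
      rw [e2]
    · simp at h1
  rintro i j hij (x | h) (y | h')
  · obtain ⟨c, hc⟩ := hb.exists_diff i j hij (y - x)
    have hspec : ∀ c' g, Sum.map (· + g) id (b c' i) = Sum.inl x →
        Sum.map (· + g) id (b c' j) = Sum.inl y →
        b c' i = Sum.inl (x - g) ∧ b c' j = Sum.inl (y - g) := by
      intro c' g h1 h2
      rcases hi : b c' i with z | z <;> rcases hj : b c' j with z' | z' <;> simp_all
      constructor
      · rw [← h1]; abel
      · rw [← h2]; abel
    rcases hi : b c i with z | z
    · rcases hj : b c j with z' | z'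
      · simp only [rowDiff, hi, hj, Option.some.injEq] at hc
        refine ⟨_, ⟨Or.inl ⟨c, x - z, rfl⟩, by simp [hi], ?_⟩, ?_⟩
        · have : z' = y - x + z := by rw [← hc]; abel
          simp [hj, this]
        · rintro w ⟨⟨c', g, rfl⟩ | ⟨v, hv, rfl⟩, h1, h2⟩
          · obtain ⟨h3, h4⟩ := hspec c' g h1 h2
            have hd : rowDiff (b c') i j = some (y - x) := by
              simp only [rowDiff, h3, h4, Option.some.injEq]
              abel
            have e1 : c' = c := hb.diff_inj i j hij c' c
              (by rw [hd]; simp only [rowDiff, hi, hj, hc]) (by simp [hd])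
            subst e1
            have e2 : g = x - z := by
              rw [h3, Sum.inl.injEq] at hi
              rw [← hi]; abel
            rw [e2]
          · simp at h1
      · simp [rowDiff, hi, hj] at hc
    · simp [rowDiff, hi] at hc
  · exact hmixed i j hij x h'
  · obtain ⟨w, ⟨hw, h1, h2⟩, hu⟩ := hmixed j i hij.symm y h
    exact ⟨w, ⟨hw, h2, h1⟩, fun w' ⟨hw', h1', h2'⟩ => hu w' ⟨hw', h2', h1'⟩⟩
  · obtain ⟨v, hv, hv1, hv2⟩ := hA.exists_row hij h h'
    refine ⟨_, ⟨Or.inr ⟨v, hv, rfl⟩, by simp [hv1], by simp [hv2]⟩, ?_⟩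
    rintro w ⟨⟨c, g, rfl⟩ | ⟨v', hv', rfl⟩, h1, h2⟩
    · have hi : (b c i).isRight := by
        rcases hi : b c i with z | z <;> simp_all
      have hj : (b c j).isRight := by
        rcases hj : b c j with z | z <;> simp_all
      obtain ⟨z, hz⟩ := Sum.isLeft_iff.1 (hb.inf_finite i j hij c hi)
      simp [hz] at hj
    · simp only [Sum.inr.injEq] at h1 h2
      rw [hA.eq_of hij hv' hv (h1.trans hv1.symm) (h2.trans hv2.symm)]

/-- The zero row together with all cyclic shifts of the given rows of length four. -/
def cyclicRows {q m : ℕ} (v : Fin m → Fin 4 → ZMod q ⊕ Fin 3) :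
    Option (Fin m × Fin 4) → Fin 4 → ZMod q ⊕ Fin 3
  | none => fun _ => Sum.inl 0
  | some x => fun i => v x.1 (i + x.2)

/-- Generating rows for a pair of orthogonal Latin squares of order ten. -/
def rowsTen : Fin 3 → Fin 4 → ZMod 7 ⊕ Fin 3 :=
  ![![.inr 0, .inl 0, .inl 1, .inl 4], ![.inr 1, .inl 0, .inl 2, .inl 1],
    ![.inr 2, .inl 0, .inl 4, .inl 2]]

/-- Generating rows for a pair of orthogonal Latin squares of order fourteen. -/
def rowsFourteen : Fin 4 → Fin 4 → ZMod 11 ⊕ Fin 3 :=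
  ![![.inr 0, .inl 0, .inl 1, .inl 3], ![.inr 1, .inl 0, .inl 3, .inl 10],
    ![.inr 2, .inl 0, .inl 4, .inl 9], ![.inl 0, .inl 6, .inl 4, .inl 1]]

/-- A finite check on `1 + 3 · 4 = 13` base rows: in any two columns, 7 give each difference in
`ZMod 7` once, and 6 contain one infinite symbol. -/
lemma isQuasiDifference_ten : IsQuasiDifference (cyclicRows rowsTen) where
  exists_diff := by decide +kernel
  diff_inj := by decide +kernel
  exists_inf := by decide +kernel
  inf_inj := by decide +kernel
  inf_finite := by decide +kernel

lemma isQuasiDifference_fourteen : IsQuasiDifference (cyclicRows rowsFourteen) where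
  exists_diff := by decide +kernel
  diff_inj := by decide +kernel
  exists_inf := by decide +kernel
  inf_inj := by decide +kernel
  inf_finite := by decide +kernel

lemma hasOA_ten : HasOA 10 := by
  obtain ⟨A, hA⟩ := hasOA_of_odd (n := 3) (by decide)
  exact (isOA_developedRows isQuasiDifference_ten hA).hasOA (by simp [ZMod.card])

lemma hasOA_fourteen : HasOA 14 := by
  obtain ⟨A, hA⟩ := hasOA_of_odd (n := 3) (by decide)
  exact (isOA_developedRows isQuasiDifference_fourteen hA).hasOA (by simp [ZMod.card])

/-! ### Existence in every order other than 2 and 6 -/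

lemma coprime_six_of_mod {t : ℕ} (h : t % 6 = 1 ∨ t % 6 = 5) : Nat.Coprime t 6 := by
  rw [Nat.coprime_iff_gcd_eq_one, Nat.gcd_comm, Nat.gcd_rec]
  rcases h with h | h <;> rw [h] <;> norm_num

lemma hasOA_of_decomposition {n : ℕ} (t u : ℕ) (hn : n = 3 * t + u) (ht : t % 6 = 1 ∨ t % 6 = 5)
    (hu : u % 2 = 1) (hut : u ≤ t) : HasOA n :=
  hn ▸ hasOA_wilson (coprime_six_of_mod ht) (hasOA_of_odd (Nat.odd_iff.2 hu)) hut

lemma hasOA_of_even_of_le {n : ℕ} (hn : n % 2 = 0) (h : 40 ≤ n) : HasOA n := by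
  -- Here `r` is even. With `t = 6s + 1` the remainder `u = r + 1` is at most 11, and `s ≥ 2` makes
  -- `t ≥ 13`; this is where `40 = 18 · 2 + 4` comes from. For `r > 10`, passing to `t = 6s + 5`
  -- makes `u = r - 11` small again.
  obtain ⟨s, r, hr, hs, hnr⟩ : ∃ s r, r < 18 ∧ 2 ≤ s ∧ n = 18 * s + 4 + r :=
    ⟨(n - 4) / 18, (n - 4) % 18, Nat.mod_lt _ (by norm_num), by omega, by omega⟩
  by_cases h11 : r ≤ 10
  · exact hasOA_of_decomposition (6 * s + 1) (r + 1) (by omega) (by omega) (by omega) (by omega)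
  · exact hasOA_of_decomposition (6 * s + 5) (r - 11) (by omega) (by omega) (by omega) (by omega)

/-- Pairs of orthogonal Latin squares exist in every order other than two and six
(Bose, Shrikhande and Parker). -/
theorem hasOA_of_ne {n : ℕ} (hn : 2 ≤ n) (h2 : n ≠ 2) (h6 : n ≠ 6) : HasOA n := by
  rcases Nat.even_or_odd n with he | ho
  · by_cases h4 : n % 4 = 0
    · obtain ⟨k, m, hm, rfl⟩ := Nat.exists_eq_two_pow_mul_odd (n := n) (by omega)
      have hk : 2 ≤ k := by
        obtain ⟨m, rfl⟩ := hm
        by_contra hk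
        interval_cases k <;> omega
      exact (hasOA_two_pow hk).mul (hasOA_of_odd hm)
    · have he' := Nat.even_iff.1 he
      by_cases h40 : 40 ≤ n
      · exact hasOA_of_even_of_le he' h40
      -- Orders 10, 14 and 30 have no decomposition `3t + u` with `t` prime to 6 and `u ≤ t` odd;
      -- the first two need explicit arrays, and `30 = 3 · 10` is a product.
      · have : n = 10 ∨ n = 14 ∨ n = 18 ∨ n = 22 ∨ n = 26 ∨ n = 30 ∨ n = 34 ∨ n = 38 := by omega
        rcases this with rfl | rfl | rfl | rfl | rfl | rfl | rfl | rfl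
        · exact hasOA_ten
        · exact hasOA_fourteen
        · exact hasOA_of_decomposition 5 3 rfl (by decide) rfl (by decide)
        · exact hasOA_of_decomposition 7 1 rfl (by decide) rfl (by decide)
        · exact hasOA_of_decomposition 7 5 rfl (by decide) rfl (by decide)
        · exact (hasOA_of_odd (n := 3) (by decide)).mul hasOA_ten
        · exact hasOA_of_decomposition 11 1 rfl (by decide) rfl (by decide)
        · exact hasOA_of_decomposition 11 5 rfl (by decide) rfl (by decide)
  · exact hasOA_of_odd ho

/-- Columns 0 and 1 serve as the input `(i, j)`, columns 2 and 3 as the output `(k, l)`. Columns 2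
and 3 together make the map bijective; the four pairs of one input and one output column give the
four Latin conditions. -/
lemma HasOA.exists_isLatinPair {d : ℕ} (h : HasOA d) :
    ∃ p : Equiv.Perm (Fin d × Fin d), IsLatinPair p := by
  obtain ⟨A, hA⟩ := h
  choose f hfA hf0 hf1 using fun x : Fin d × Fin d =>
    hA.exists_row (i := 0) (j := 1) (by decide) x.1 x.2
  have hkey : ∀ i j : Fin 4, i ≠ j → ∀ x y, f x i = f y i → f x j = f y j → x = y := by
    intro i j hij x y h1 h2
    have := hA.eq_of hij (hfA x) (hfA y) h1 h2
    exact Prod.ext (by rw [← hf0 x, ← hf0 y, this]) (by rw [← hf1 x, ← hf1 y, this])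
  have hinj : Function.Injective fun x => (f x 2, f x 3) := fun x y hxy =>
    hkey 2 3 (by decide) x y (congrArg Prod.fst hxy) (congrArg Prod.snd hxy)
  refine ⟨Equiv.ofBijective _ (Finite.injective_iff_bijective.1 hinj), ⟨?_, ?_⟩, ?_, ?_⟩
  · intro i j j' h
    exact congrArg Prod.snd (hkey 0 2 (by decide) (i, j) (i, j') (by rw [hf0, hf0]) h)
  · intro j i i' h
    exact congrArg Prod.fst (hkey 1 3 (by decide) (i, j) (i', j) (by rw [hf1, hf1]) h)
  · intro i j j' h
    exact congrArg Prod.snd (hkey 0 3 (by decide) (i, j) (i, j') (by rw [hf0, hf0]) h)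
  · intro j i i' h
    exact congrArg Prod.fst (hkey 1 2 (by decide) (i, j) (i', j) (by rw [hf1, hf1]) h)

end EntPow

end

theorem theorem5 (d : ℕ) (hd : 2 ≤ d) (p : Equiv.Perm (Fin d × Fin d)) :
    -- the bound `d/(d+1)`, valid for every unitary
    (∀ U ∈ Matrix.unitaryGroup (Fin d × Fin d) ℂ,
      EntPow.entanglingPower U ≤ (d : ℝ) / ((d : ℝ) + 1)) ∧
    -- attaining this maximum value is equivalent to the four conditions
    (EntPow.entanglingPower (EntPow.permOp p) = (d : ℝ) / ((d : ℝ) + 1) ↔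
      EntPow.FourConditions (EntPow.permOp p)) ∧
    -- for `d ≠ 2, 6`, so is being a maximizer over the unitary group
    (d ≠ 2 → d ≠ 6 →
      (IsMaxOn EntPow.entanglingPower
          (Matrix.unitaryGroup (Fin d × Fin d) ℂ : Set (Matrix (Fin d × Fin d) (Fin d × Fin d) ℂ))
          (EntPow.permOp p) ↔
        EntPow.FourConditions (EntPow.permOp p))) ∧
    -- the four conditions are equivalent to `Q_P = Q_PS = d²`
    (EntPow.FourConditions (EntPow.permOp p) ↔
      EntPow.Q p = d ^ 2 ∧ EntPow.Q (p * EntPow.swapPerm d) = d ^ 2) := by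
  have hmax := EntPow.entanglingPower_permOp_eq_max_iff hd p
  have hfour := EntPow.fourConditions_permOp_iff p
  refine ⟨fun U hU => EntPow.entanglingPower_le hd hU, hmax.trans hfour.symm, fun h2 h6 => ?_,
    hfour.trans (EntPow.Q_eq_sq_iff_isLatinPair p).symm⟩
  rw [hfour, ← hmax]
  constructor
  · intro h
    -- A permutation attaining `d / (d + 1)` exists, so any maximizer must reach that value too.
    obtain ⟨q, hq⟩ := (EntPow.hasOA_of_ne hd h2 h6).exists_isLatinPair
    refine le_antisymm (EntPow.entanglingPower_le hd (EntPow.permOp_mem_unitaryGroup p)) ?_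
    rw [← (EntPow.entanglingPower_permOp_eq_max_iff hd q).2 hq]
    exact h (EntPow.permOp_mem_unitaryGroup q)
  · intro h U hU
    exact (EntPow.entanglingPower_le hd hU).trans h.ge
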